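/- **Setting.** A finite 2-complex $Y=(V,E,F)$ consists of a finite graph with oriented edges (each edge $e$ has an inverse $e^{-1}\neq e$) and finitely many oriented faces; every face $f$ has a boundary $\partial f$, a nontrivial cyclically reduced loop of the graph with a starting point, and an inverse face with $\partial(f^{-1})=(\partial f)^{-1}$. A geometric edge (face) is a pair of mutually inverse edges (faces); $|Y|$ is the number of geometric faces. $Y$ is planar if it can be embedded in the plane. For a planar $Y$, $|\partial Y|$ is the number of geometric edges adjacent to exactly one face plus twice the number of geometric edges adjacent to no face (adjacency being counted with multiplicity). A geometric form $(Y,\lambda)$ is a finite connected 2-complex $Y$ in which every edge lies on the boundary of a face, together with lengths $\lambda_e\in\,]0,1]$ of its geometric edges such that every face boundary has total length at most $1$. A sequence $(D_\ell)$ is of this geometric form if, for $\ell$ large, $D_\ell$ is obtained from $Y$ by dividing every geometric edge $e$ into $\lambda_e\ell+o(\ell)$ edges of length $1$, such that every face boundary of $D_\ell$ has length at most $\ell$. Fix $m\ge 2$, and let $B_\ell$ be the set of cyclically reduced words of length at most $\ell$ in $x_1^{\pm},\dots,x_m^{\pm}$. Let $(R_\ell)$ be a sequence of random subsets of $B_\ell$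 such that the law of $R_\ell$ is invariant under all permutations of $B_\ell$, and $\log_{|B_\ell|}|R_\ell|$ converges in probability to a real number $d$ (so that $d\in[0,1]$). The sequence of random groups at density $d$ is $G_\ell(m,d)=\langle x_1,\dots,x_m\mid R_\ell\rangle$. A van Kampen 2-complex of $\langle X\mid R\rangle$ is a 2-complex with labels $\varphi_1$ of its oriented edges in $X^{\pm}$ and $\varphi_2$ of its oriented faces in $R^{\pm}$ such that $\varphi_1(e^{-1})=\varphi_1(e)^{-1}$, $\varphi_2(f^{-1})=\varphi_2(f)^{-1}$ and $\varphi_1(\partial f)=\varphi_2(f)$. It is reduced if no two different oriented faces have the same label and a common oriented edge at the same position of their boundaries. A 2-complex is fillable by $\langle X\mid R\rangle$ if it is the underlying 2-complex of a reduced van Kampen 2-complex of $\langle X\mid R\rangle$. **Corollary.** Let $(G_\ell(m,d))$ be a sequence of random groups with $m\ge 2$ generators at density $d$, and let $s>0$. Let $(D_\ell)$ be a sequence of finite planar 2-complexes of the same geometric form such that every face boundary of $D_\ell$ has length exactly $\ell$ for all large $\ell$. If, for all large $\ell$, every sub-2-complex $D'_\ell$ of $D_\ell$ satisfies $$|\partial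 D'_\ell|\ \ge\ (1-2d+s)\,|D'_\ell|\,\ell ,$$ then asymptotically almost surely $D_\ell$ is fillable by $G_\ell(m,d)$, i.e. the probability that $D_\ell$ is fillable by $G_\ell(m,d)$ tends to $1$ as $\ell\to\infty$. -/

import Mathlib

open Filter Topology MeasureTheory

namespace RandomGroups

/-! ### Finite combinatorial 2-complexes

A geometric edge `e` is stored with a reference orientation; the two oriented edges over it are
`(e, true)` (from `src e` to `tgt e`) and `(e, false)` (the inverse edge).  Likewise a geometric
face `f` is stored with a reference boundary loop `bdry f`, and the two oriented faces over it are
`(f, true)` and `(f, false)`, the boundary of the latter being the inverse loop.  The inverse of a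
word in oriented edges, or in letters `x_i^±`, is `FreeGroup.invRev`. -/

/-- A finite graph with vertices `V` and geometric edges `E` (loops and multiple edges allowed). -/
structure FinGraph where
  V : Type
  E : Type
  [finV : Finite V]
  [finE : Finite E]
  src : E → V
  tgt : E → V

namespace FinGraph

attribute [instance] finV finE

/-- Oriented edges. -/
abbrev Dart (G : FinGraph) : Type := G.E × Bool

/-- Starting point of an oriented edge. -/
def init (G : FinGraph) (a : G.Dart) : G.V := if a.2 then G.src a.1 else G.tgt a.1

/-- Ending point of an oriented edge. -/
def term (G : FinGraph) (a : G.Dart) : G.V := if a.2 then G.tgt a.1 else G.src a.1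

/-- The oriented edge `b` may follow the oriented edge `a` in a reduced path: it starts where `a`
ends, and it is not the inverse of `a`. -/
def Follows (G : FinGraph) (a b : G.Dart) : Prop :=
  G.term a = G.init b ∧ (a.1 = b.1 → a.2 = b.2)

/-- A nontrivial cyclically reduced loop, given from its starting point. -/
def IsReducedLoop (G : FinGraph) (l : List G.Dart) : Prop :=
  l ≠ [] ∧ Cycle.Chain G.Follows (l : Cycle G.Dart)

/-- The connected components. -/
def Component (G : FinGraph) : Type := Quot fun v w : G.V => ∃ a : G.Dart, G.init a = v ∧ G.term a = w

/-- The connected component of a vertex. -/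
def component (G : FinGraph) (v : G.V) : G.Component := Quot.mk _ v

/-- Reversal of oriented edges, as a permutation. -/
def flip (G : FinGraph) : Equiv.Perm G.Dart where
  toFun a := (a.1, !a.2)
  invFun a := (a.1, !a.2)
  left_inv a := by simp
  right_inv a := by simp

/-- A rotation system: a cyclic order on the oriented edges that start at each vertex. -/
def IsRotation (G : FinGraph) (σ : Equiv.Perm G.Dart) : Prop :=
  ∀ a b, σ.SameCycle a b ↔ G.init a = G.init b

/-- The face-tracing permutation of a rotation system: traverse `a`, then take the next oriented
edge in the rotation at its end. Its cycles are the boundary walks of the regions that are cut out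
by the graph, drawn on a surface with this rotation system. -/
def trace (G : FinGraph) (σ : Equiv.Perm G.Dart) : Equiv.Perm G.Dart := σ * G.flip

/-- Euler's formula `#vertices - #edges + #regions = 2` for every component, summed over
the components. As the genus of each component is nonnegative, this says that the rotation system
draws every component on a sphere. (A component that consists of one vertex has one region, which
no oriented edge sees.) -/
def IsSpherical (G : FinGraph) (σ : Equiv.Perm G.Dart) : Prop :=
  Nat.card G.V + (Nat.card (Quotient (Equiv.Perm.SameCycle.setoid (G.trace σ))) +
      Nat.card {v : G.V // ∀ a : G.Dart, G.init a ≠ v}) =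
    Nat.card G.E + 2 * Nat.card G.Component

end FinGraph

/-- A finite oriented combinatorial 2-complex with geometric faces `F`. -/
structure TwoComplex extends FinGraph where
  F : Type
  [finF : Finite F]
  bdry : F → List (E × Bool)
  isReducedLoop_bdry : ∀ f, toFinGraph.IsReducedLoop (bdry f)

namespace TwoComplex

attribute [instance] finF

/-- The boundary loop of an oriented face. -/
def orientedBdry (Y : TwoComplex) (f : Y.F × Bool) : List Y.Dart :=
  if f.2 then Y.bdry f.1 else FreeGroup.invRev (Y.bdry f.1)

/-- Connected (and nonempty). -/
def IsConnected (Y : TwoComplex) : Prop := Nat.card Y.Component = 1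

/-- Every geometric edge lies on the boundary of some face. -/
def NoIsolatedEdges (Y : TwoComplex) : Prop := ∀ e : Y.E, ∃ f : Y.F, ∃ a ∈ Y.bdry f, a.1 = e

/-- Planarity: the 1-skeleton has a drawing in which every component lies on a sphere, such that
the faces, with suitable orientations, are distinct regions of the drawing, and in every component
at least one region (which contains the point at infinity of the plane) is not a face. -/
def IsPlanar (Y : TwoComplex) : Prop :=
  ∃ σ : Equiv.Perm Y.Dart, Y.IsRotation σ ∧ Y.IsSpherical σ ∧
    ∃ o : Y.F → Bool,
      (∀ f, (Y.orientedBdry (f, o f)).Nodup ∧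
        Cycle.Chain (fun a b => Y.trace σ a = b) (Y.orientedBdry (f, o f) : Cycle Y.Dart)) ∧
      (∀ f g, f ≠ g → (Y.orientedBdry (f, o f)).Disjoint (Y.orientedBdry (g, o g))) ∧
      ∀ a : Y.Dart, ∃ b : Y.Dart, Y.component (Y.init b) = Y.component (Y.init a) ∧
        ∀ f, b ∉ Y.orientedBdry (f, o f)

/-- A sub-2-complex. -/
structure Sub (Y : TwoComplex) where
  verts : Set Y.V
  edges : Set Y.E
  faces : Set Y.F
  src_mem : ∀ e ∈ edges, Y.src e ∈ verts
  tgt_mem : ∀ e ∈ edges, Y.tgt e ∈ verts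
  bdry_mem : ∀ f ∈ faces, ∀ a ∈ Y.bdry f, a.1 ∈ edges

/-- The number of faces of `Z` adjacent to the edge `e`, counted with multiplicity: the number of
passages of the boundary loops of the faces of `Z` through `e`, in either direction. -/
noncomputable def Sub.adjacency {Y : TwoComplex} (Z : Y.Sub) (e : Y.E) : ℕ :=
  {p : Y.F × ℕ | p.1 ∈ Z.faces ∧ ∃ b : Bool, (Y.bdry p.1)[p.2]? = some (e, b)}.ncard

/-- The boundary length `|∂Z|`: edges adjacent to one face count once, edges adjacent to no face
count twice. -/
noncomputable def Sub.bdryLength {Y : TwoComplex} (Z : Y.Sub) : ℕ :=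
  {e ∈ Z.edges | Z.adjacency e = 1}.ncard + 2 * {e ∈ Z.edges | Z.adjacency e = 0}.ncard

/-! ### Subdivision -/

section Subdivide

variable (Y : TwoComplex) (n : Y.E → ℕ+)

/-- The `i`-th vertex (`0 ≤ i ≤ n e`) on the edge `e` divided into `n e` edges. -/
def divPoint (e : Y.E) (i : ℕ) : Y.V ⊕ (Σ e : Y.E, Fin ((n e : ℕ) - 1)) :=
  if i = 0 then Sum.inl (Y.src e)
  else if h : i - 1 < (n e : ℕ) - 1 then Sum.inr ⟨e, ⟨i - 1, h⟩⟩
  else Sum.inl (Y.tgt e)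

/-- The graph obtained by dividing every edge `e` into `n e` edges. -/
def divGraph : FinGraph where
  V := Y.V ⊕ (Σ e : Y.E, Fin ((n e : ℕ) - 1))
  E := Σ e : Y.E, Fin (n e : ℕ)
  src x := Y.divPoint n x.1 x.2
  tgt x := Y.divPoint n x.1 (x.2 + 1)

/-- The path into which an oriented edge is divided. -/
def divPath (a : Y.Dart) : List (Y.divGraph n).Dart :=
  let p : List (Y.divGraph n).Dart :=
    (List.finRange (n a.1 : ℕ)).map fun i => (⟨a.1, i⟩, true)
  if a.2 then p else FreeGroup.invRev p

theorem divPath_eq (a : Y.Dart) : Y.divPath n a =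
    if a.2 then (List.ofFn fun i : Fin (n a.1 : ℕ) =>
      ((⟨a.1, i⟩, true) : (Y.divGraph n).Dart))
    else (List.ofFn fun i : Fin (n a.1 : ℕ) =>
      ((⟨a.1, i⟩, false) : (Y.divGraph n).Dart)).reverse := by
  unfold divPath
  split_ifs <;> simp [FreeGroup.invRev, List.ofFn_eq_map, Function.comp_def]

theorem divPath_ne_nil (a : Y.Dart) : Y.divPath n a ≠ [] := by
  have := (n a.1).pos
  rw [divPath_eq]
  split_ifs <;> simp [List.ofFn_eq_nil_iff]

theorem isChain_divPath (a : Y.Dart) : (Y.divPath n a).IsChain (Y.divGraph n).Follows := by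
  rw [divPath_eq]
  split_ifs
  · rw [List.isChain_ofFn]
    intro i hi
    simp [FinGraph.Follows, FinGraph.term, FinGraph.init, divGraph]
  · rw [List.isChain_reverse, List.isChain_ofFn]
    intro i hi
    simp [FinGraph.Follows, FinGraph.term, FinGraph.init, divGraph]

theorem divPoint_zero (e : Y.E) : Y.divPoint n e 0 = Sum.inl (Y.src e) := by simp [divPoint]

theorem divPoint_last (e : Y.E) : Y.divPoint n e (n e) = Sum.inl (Y.tgt e) := by
  simp [divPoint]

theorem head_divPath (a : Y.Dart) : ∀ y ∈ (Y.divPath n a).head?,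
    y.1.1 = a.1 ∧ y.2 = a.2 ∧ (Y.divGraph n).init y = Sum.inl (Y.init a) := by
  obtain ⟨e, b⟩ := a
  have hpos := (n e).pos
  intro y hy
  rw [divPath_eq] at hy
  cases b
  · simp only [Bool.false_eq_true, if_false, List.head?_reverse, List.getLast?_eq_getElem?,
      List.length_ofFn, List.getElem?_ofFn, Option.mem_def, Option.dite_none_right_eq_some,
      Option.some.injEq] at hy
    obtain ⟨_, rfl⟩ := hy
    refine ⟨rfl, rfl, ?_⟩
    have : (n e : ℕ) - 1 + 1 = n e := by omega
    simp [FinGraph.init, divGraph, this, divPoint_last]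
  · simp only [if_true, List.head?_eq_getElem?, List.getElem?_ofFn, Option.mem_def,
      Option.dite_none_right_eq_some, Option.some.injEq] at hy
    obtain ⟨_, rfl⟩ := hy
    exact ⟨rfl, rfl, by simp [FinGraph.init, divGraph, divPoint_zero]⟩

theorem getLast_divPath (a : Y.Dart) : ∀ y ∈ (Y.divPath n a).getLast?,
    y.1.1 = a.1 ∧ y.2 = a.2 ∧ (Y.divGraph n).term y = Sum.inl (Y.term a) := by
  obtain ⟨e, b⟩ := a
  have hpos := (n e).pos
  intro y hy
  rw [divPath_eq] at hy
  cases b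
  · simp only [Bool.false_eq_true, if_false, List.getLast?_reverse, List.head?_eq_getElem?,
      List.getElem?_ofFn, Option.mem_def, Option.dite_none_right_eq_some,
      Option.some.injEq] at hy
    obtain ⟨_, rfl⟩ := hy
    exact ⟨rfl, rfl, by simp [FinGraph.term, divGraph, divPoint_zero]⟩
  · simp only [if_true, List.getLast?_eq_getElem?, List.length_ofFn, List.getElem?_ofFn,
      Option.mem_def, Option.dite_none_right_eq_some, Option.some.injEq] at hy
    obtain ⟨_, rfl⟩ := hy
    refine ⟨rfl, rfl, ?_⟩
    have : (n e : ℕ) - 1 + 1 = n e := by omega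
    simp [FinGraph.term, divGraph, this, divPoint_last]

theorem follows_divPath {a b : Y.Dart} (h : Y.Follows a b) :
    ∀ x ∈ (Y.divPath n a).getLast?, ∀ y ∈ (Y.divPath n b).head?,
      (Y.divGraph n).Follows x y := by
  intro x hx y hy
  obtain ⟨hx1, hx2, hx3⟩ := Y.getLast_divPath n a x hx
  obtain ⟨hy1, hy2, hy3⟩ := Y.head_divPath n b y hy
  refine ⟨by rw [hx3, hy3, h.1], fun hxy => ?_⟩
  rw [hx2, hy2]
  exact h.2 (by rw [← hx1, ← hy1, hxy])

theorem isReducedLoop_divide {l : List Y.Dart} (h : Y.IsReducedLoop l) :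
    (Y.divGraph n).IsReducedLoop (l.flatMap (Y.divPath n)) := by
  obtain ⟨h0, h1⟩ := h
  obtain ⟨a, t, rfl⟩ := List.exists_cons_of_ne_nil h0
  have key : ((a :: (t ++ [a])).flatMap (Y.divPath n)).IsChain (Y.divGraph n).Follows := by
    rw [List.flatMap_def, List.isChain_flatten]
    · refine ⟨?_, ?_⟩
      · intro p hp
        obtain ⟨c, -, rfl⟩ := List.mem_map.1 hp
        exact Y.isChain_divPath n c
      · rw [List.isChain_map]
        exact List.IsChain.imp (fun _ _ hab => Y.follows_divPath n hab)
          ((Cycle.chain_coe_cons _ _ _).1 h1)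
    · intro hp
      obtain ⟨c, -, hc⟩ := List.mem_map.1 hp
      exact Y.divPath_ne_nil n c hc
  obtain ⟨x, p, hp⟩ := List.exists_cons_of_ne_nil (Y.divPath_ne_nil n a)
  have e1 : (a :: t).flatMap (Y.divPath n) = x :: (p ++ t.flatMap (Y.divPath n)) := by
    simp [List.flatMap_cons, hp]
  have e2 : (a :: (t ++ [a])).flatMap (Y.divPath n) =
      (x :: ((p ++ t.flatMap (Y.divPath n)) ++ [x])) ++ p := by
    simp [List.flatMap_cons, List.flatMap_append, hp]
  rw [e2] at key
  rw [e1]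
  exact ⟨by simp, (Cycle.chain_coe_cons _ _ _).2 key.left_of_append⟩

/-- The 2-complex obtained from `Y` by dividing every edge `e` into `n e` edges. -/
def subdivide : TwoComplex where
  toFinGraph := Y.divGraph n
  F := Y.F
  bdry f := (Y.bdry f).flatMap (Y.divPath n)
  isReducedLoop_bdry f := Y.isReducedLoop_divide n (Y.isReducedLoop_bdry f)

end Subdivide

end TwoComplex

/-! ### Geometric forms -/

/-- A geometric form: a finite connected 2-complex without isolated edges, with edge lengths in
`]0, 1]` such that every face boundary has length at most `1`. -/
structure GeometricForm where
  Y : TwoComplex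
  isConnected : Y.IsConnected
  noIsolatedEdges : Y.NoIsolatedEdges
  len : Y.E → ℝ
  len_pos : ∀ e, 0 < len e
  len_le_one : ∀ e, len e ≤ 1
  bdry_le_one : ∀ f, ((Y.bdry f).map fun a => len a.1).sum ≤ 1

/-- The sequence `(D ℓ)` is of the geometric form `Φ = (Y, λ)`: for large `ℓ`, `D ℓ` is obtained
from `Y` by dividing every edge `e` into `λ_e ℓ + o(ℓ)` edges of length `1`, such that every face
boundary has length at most `ℓ`. -/
def GeometricForm.IsForm (Φ : GeometricForm) (D : ℕ → TwoComplex) : Prop :=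
  ∃ n : ℕ → Φ.Y.E → ℕ+,
    (∀ e, Tendsto (fun ℓ : ℕ => ((n ℓ e : ℕ) : ℝ) / (ℓ : ℝ)) atTop (𝓝 (Φ.len e))) ∧
    ∀ᶠ ℓ in atTop, D ℓ = Φ.Y.subdivide (n ℓ) ∧ ∀ f, ((D ℓ).bdry f).length ≤ ℓ

/-- The sequence `(D ℓ)` consists of 2-complexes of the same geometric form. -/
def SameGeometricForm (D : ℕ → TwoComplex) : Prop := ∃ Φ : GeometricForm, Φ.IsForm D

/-! ### Van Kampen 2-complexes -/

/-- Words in the letters `x_1^±, …, x_m^±`. -/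
abbrev Word (m : ℕ) : Type := List (Fin m × Bool)

/-- A van Kampen 2-complex with respect to the presentation `⟨x_1, …, x_m | R⟩` whose underlying
2-complex is `Y`: compatible labels on the oriented edges by letters `x_i^±` and on the oriented
faces by relators or inverses of relators. -/
structure VanKampen (m : ℕ) (R : Set (Word m)) (Y : TwoComplex) where
  edgeLabel : Y.Dart → Fin m × Bool
  edgeLabel_inv : ∀ e b, edgeLabel (e, !b) = ((edgeLabel (e, b)).1, !(edgeLabel (e, b)).2)
  faceLabel : Y.F × Bool → Word m
  faceLabel_mem : ∀ f, faceLabel f ∈ R ∨ FreeGroup.invRev (faceLabel f) ∈ R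
  faceLabel_inv : ∀ f b, faceLabel (f, !b) = FreeGroup.invRev (faceLabel (f, b))
  compatible : ∀ f, (Y.orientedBdry f).map edgeLabel = faceLabel f

/-- No reducible pair of faces: no two different oriented faces have the same label and a common
oriented edge at the same position of their boundaries. -/
def VanKampen.IsReduced {m : ℕ} {R : Set (Word m)} {Y : TwoComplex} (W : VanKampen m R Y) : Prop :=
  ∀ f g : Y.F × Bool, f ≠ g → W.faceLabel f = W.faceLabel g →
    ∀ (j : ℕ) (a : Y.Dart), (Y.orientedBdry f)[j]? = some a → (Y.orientedBdry g)[j]? ≠ some a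

/-- `Y` is fillable by the presentation `⟨x_1, …, x_m | R⟩`: it is the underlying 2-complex of a
reduced van Kampen 2-complex. -/
def TwoComplex.Fillable (Y : TwoComplex) (m : ℕ) (R : Set (Word m)) : Prop :=
  ∃ W : VanKampen m R Y, W.IsReduced

/-! ### Random groups in the permutation invariant density model -/

/-- The set `B_ℓ` of cyclically reduced words of length at most `ℓ`. -/
abbrev B (m ℓ : ℕ) : Type := {w : Word m // FreeGroup.IsCyclicallyReduced w ∧ w.length ≤ ℓ}

instance (m ℓ : ℕ) : Finite (B m ℓ) :=
  ((List.finite_length_le (Fin m × Bool) ℓ).subset fun _ hw => hw.2).to_subtype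

/-- `R ℓ`, a random variable on the probability space `(Ω ℓ, P ℓ)`, is a random subset of `B_ℓ`;
the sequence is permutation invariant, and densable with density `d`. These are the random relators
of a sequence of random groups `G_ℓ(m, d) = ⟨x_1, …, x_m | R_ℓ⟩`. -/
structure IsRandomRelators (m : ℕ) (d : ℝ) {Ω : ℕ → Type*} [∀ ℓ, MeasurableSpace (Ω ℓ)]
    (P : ∀ ℓ, Measure (Ω ℓ)) (R : ∀ ℓ, Ω ℓ → Set (B m ℓ)) : Prop where
  /-- Each `R ℓ` is measurable (it takes finitely many values). -/
  measurable : ∀ ℓ S, MeasurableSet {ω | R ℓ ω = S}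
  /-- The law of `R ℓ` is invariant under the permutations of `B_ℓ`. -/
  invariant : ∀ ℓ (π : Equiv.Perm (B m ℓ)) S, P ℓ {ω | R ℓ ω = π '' S} = P ℓ {ω | R ℓ ω = S}
  /-- `log_{|B_ℓ|} |R_ℓ|` (which is `-∞` when `R_ℓ` is empty) converges in probability to `d`. -/
  densable : ∀ ε > 0, Tendsto (fun ℓ => P ℓ {ω | (R ℓ ω).Nonempty ∧
    |Real.logb (Nat.card (B m ℓ)) ((R ℓ ω).ncard) - d| ≤ ε}) atTop (𝓝 1)

end RandomGroups

/-! The proof is a second moment argument. Write b = 2m - 1. Label each edge e of the form Y,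
divided into n(e) parts, by a reduced word of length n(e). There are about b^(sum of n(e))
labelings, and each one gives every face a boundary word. If all face words of some labeling lie in
R_ℓ, the complex is filled. Given its cardinality r, the set R_ℓ is uniform among the r-element
subsets of B_ℓ (`measureReal_le_of_card_filter_le`), so it suffices that few r-subsets miss all
labelings. By Chebyshev's inequality this holds when two labelings rarely share face words
(`card_filter_powersetCard_le`).

Prescribing the words of a nonempty set A of faces fixes the words on the edges around A, so it
leaves a proportion of about b^(-E(A)) of the labelings, E(A) being the number of edges of the
closure of A. Sharing |A| words gains a factor of about (|B_ℓ|/r)^|A|, roughly b^((1-d)ℓ|A|). In a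
planar complex an edge has at most two adjacent faces, so 2E(A) = |A|ℓ + |∂A|, and the boundary
hypothesis gives E(A) ≥ (1 - d + s/2)ℓ|A|. The product of the two factors therefore decays
exponentially in ℓ.

The labels must also make the face words cyclically reduced, pairwise distinct and not inverse to
each other. For this, every oriented edge e of Y receives a fixed prefix, independent of ℓ. First
letters come from a proper colouring of the rotation system, so nothing cancels at a corner
(`IsPlanar.exists_corner_coloring`); the prefixes form a prefix code, so a face word determines its
boundary path (`faceWord_ne`), and distinct faces have distinct boundaries up to inversion
(`IsPlanar.bdry_ne`). The prefixes cost only a constant factor in the number of labelings. -/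

namespace RandomGroups

/-! ### Second moment method for uniform subsets of fixed size -/

section SecondMoment

/-- `(n - j).choose (r - j)` counts the r-subsets containing a given j-set. Requiring one more
element multiplies the count by (r - j)/(n - j). -/
theorem choose_sub_succ {n r j : ℕ} (hrn : r ≤ n) (hj : j < r) :
    ((n - (j + 1)).choose (r - (j + 1)) : ℝ) * ((n : ℝ) - j) =
      ((n - j).choose (r - j) : ℝ) * ((r : ℝ) - j) := by
  obtain ⟨r', rfl⟩ : ∃ r', r = j + 1 + r' := ⟨r - (j + 1), by omega⟩
  obtain ⟨n', rfl⟩ : ∃ n', n = j + 1 + n' := ⟨n - (j + 1), by omega⟩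
  have h := Nat.add_one_mul_choose_eq n' r'
  have e1 : j + 1 + n' - (j + 1) = n' := by omega
  have e2 : j + 1 + r' - (j + 1) = r' := by omega
  have e3 : j + 1 + n' - j = n' + 1 := by omega
  have e4 : j + 1 + r' - j = r' + 1 := by omega
  rw [e1, e2, e3, e4]
  have h' : ((n' : ℝ) + 1) * (n'.choose r' : ℝ) = ((n' + 1).choose (r' + 1) : ℝ) * ((r' : ℝ) + 1) := by
    exact_mod_cast h
  push_cast
  linear_combination h'

/-- Negative correlation: as r ≤ n, the factor (r - j)/(n - j) decreases with j, so containing k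
given elements makes containing t others less likely. -/
theorem choose_sub_add_mul_le {n r : ℕ} (hrn : r ≤ n) (k t : ℕ) (h : k + t ≤ r) :
    ((n - (k + t)).choose (r - (k + t)) : ℝ) * (n.choose r : ℝ) ≤
      ((n - k).choose (r - k) : ℝ) * ((n - t).choose (r - t) : ℝ) := by
  induction t with
  | zero => simp
  | succ t ih =>
    have ih := ih (by omega)
    have e1 := choose_sub_succ hrn (j := k + t) (by omega)
    have e2 := choose_sub_succ hrn (j := t) (by omega)
    rw [← Nat.add_assoc]
    set a := ((n - (k + t + 1)).choose (r - (k + t + 1)) : ℝ)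
    set a' := ((n - (k + t)).choose (r - (k + t)) : ℝ)
    set b := ((n - (t + 1)).choose (r - (t + 1)) : ℝ)
    set b' := ((n - t).choose (r - t) : ℝ)
    set c := (n.choose r : ℝ)
    set g := ((n - k).choose (r - k) : ℝ)
    have hrn' : (r : ℝ) ≤ n := by exact_mod_cast hrn
    have hr : ((k + t + 1 : ℕ) : ℝ) ≤ r := by exact_mod_cast h
    push_cast at hr e1
    have hb' : 0 ≤ b' := Nat.cast_nonneg _
    have hg : 0 ≤ g := Nat.cast_nonneg _
    have hk : (0 : ℝ) ≤ k := Nat.cast_nonneg _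
    have hn1 : 0 < (n : ℝ) - (k + t) := by linarith
    have hn2 : 0 < (n : ℝ) - t := by linarith
    have ea : a = a' * ((r - (k + t)) / (n - (k + t))) := by field_simp; linarith
    have eb : b = b' * ((r - t) / (n - t)) := by field_simp; linarith
    have hρ : ((r : ℝ) - (k + t)) / (n - (k + t)) ≤ (r - t) / (n - t) := by
      rw [div_le_div_iff₀ hn1 hn2]
      nlinarith
    have hρ0 : 0 ≤ ((r : ℝ) - (k + t)) / (n - (k + t)) :=
      div_nonneg (by linarith) hn1.le
    calc a * c = (a' * c) * ((r - (k + t)) / (n - (k + t))) := by rw [ea]; ring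
      _ ≤ (g * b') * ((r - (k + t)) / (n - (k + t))) := by gcongr
      _ ≤ (g * b') * ((r - t) / (n - t)) := by gcongr
      _ = g * b := by rw [eb]; ring

/-- Dropping one required element costs a factor (n - j)/(r - j), which is at most 2n/r because j ≤
r/2. -/
theorem choose_sub_le_mul_pow {n r k : ℕ} (hrn : r ≤ n) (hr : 0 < r) (hk : 2 * k ≤ r) (i : ℕ)
    (hi : i ≤ k) :
    ((n - (k - i)).choose (r - (k - i)) : ℝ) ≤
      ((n - k).choose (r - k) : ℝ) * (2 * n / r) ^ i := by
  induction i with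
  | zero => simp
  | succ i ih =>
    have ih := ih (by omega)
    obtain ⟨j, hj⟩ : ∃ j, k = j + (i + 1) := ⟨k - (i + 1), by omega⟩
    have h1 : k - (i + 1) = j := by omega
    have h2 : k - i = j + 1 := by omega
    have e := choose_sub_succ hrn (j := j) (by omega)
    rw [h1]
    rw [h2] at ih
    set a := ((n - (j + 1)).choose (r - (j + 1)) : ℝ)
    set a' := ((n - j).choose (r - j) : ℝ)
    set g := ((n - k).choose (r - k) : ℝ)
    have ha' : 0 ≤ a' := Nat.cast_nonneg _
    have ha : 0 ≤ a := Nat.cast_nonneg _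
    have hr' : (0 : ℝ) < r := by exact_mod_cast hr
    have hj2 : (2 : ℝ) * j ≤ r := by exact_mod_cast (by omega : 2 * j ≤ r)
    have hj0 : (0 : ℝ) ≤ j := Nat.cast_nonneg _
    have key : a' ≤ a * (2 * n / r) := by
      rw [← mul_div_assoc, le_div_iff₀ hr']
      nlinarith
    calc a' ≤ a * (2 * n / r) := key
      _ ≤ (g * (2 * n / r) ^ i) * (2 * n / r) := by gcongr
      _ = _ := by ring

open Classical in
/-- The second moment method for uniformly random `r`-element subsets `S` of a finite set: if the
overlaps of pairs of tuples `w x`, `w y` are rare, then few `S` contain no tuple `w x`. -/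
theorem card_filter_powersetCard_le {β F I : Type*} [Fintype β] [Fintype F] [Fintype I]
    [Nonempty I] (w : I → F → β) (hw : ∀ x, Function.Injective (w x)) (r : ℕ)
    (hr0 : 0 < r) (hr : 2 * Fintype.card F ≤ r) (hrn : r ≤ Fintype.card β) (η : ℝ) (hη0 : 0 ≤ η)
    (H : ∀ A : Finset F, A.Nonempty → ∀ v : F → β,
      ((Finset.univ.filter fun y => ∀ f ∈ A, w y f = v f).card : ℝ) *
        (2 * Fintype.card β / r) ^ A.card ≤ η * Fintype.card I) :
    ((((Finset.univ : Finset β).powersetCard r).filter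
        fun S => ∀ x, ∃ f, w x f ∉ S).card : ℝ) ≤
      (2 ^ Fintype.card F * (Fintype.card F : ℝ) ^ Fintype.card F * η) *
        ((Fintype.card β).choose r : ℝ) := by
  set n := Fintype.card β with hn
  set k := Fintype.card F with hk
  set N : ℝ := ((Fintype.card I : ℕ) : ℝ) with hN
  have hNpos : 0 < N := by rw [hN]; exact_mod_cast Fintype.card_pos
  set T : ℝ := 2 * n / r with hT
  have hT0 : 0 ≤ T := by positivity
  let a : ℕ → ℝ := fun j => ((n - j).choose (r - j) : ℝ)
  have ha0 : a 0 = (n.choose r : ℝ) := by simp [a]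
  have ha0pos : 0 < a 0 := by rw [ha0]; exact_mod_cast Nat.choose_pos hrn
  have hakpos : 0 < a k := by
    simp only [a]; exact_mod_cast Nat.choose_pos (by omega)
  let P := (Finset.univ : Finset β).powersetCard r
  have hPcard : (P.card : ℝ) = a 0 := by simp [P, ha0, hn]
  let im : I → Finset β := fun x => Finset.univ.image (w x)
  have him : ∀ x, (im x).card = k := fun x => by
    simp [im, Finset.card_image_of_injective _ (hw x), hk]
  let X : Finset β → ℝ := fun S => ∑ x, if im x ⊆ S then 1 else 0
  have hcount : ∀ U : Finset β, U.card ≤ r → (∑ S ∈ P, if U ⊆ S then (1 : ℝ) else 0) = a U.card := by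
    intro U hU
    rw [Finset.sum_boole, Finset.card_filter_powersetCard_subset U _ r (Finset.subset_univ _) hU]
    simp [a, hn]
  have hsum1 : ∑ S ∈ P, X S = N * a k := by
    simp only [X]
    rw [Finset.sum_comm]
    rw [Finset.sum_congr rfl fun x _ => hcount (im x) (by rw [him]; omega)]
    simp [him, hN]
  -- The faces whose word under y occurs anywhere in the tuple of x, possibly at another face.
  let A : I → I → Finset F := fun x y => Finset.univ.filter fun f => w y f ∈ im x
  have hunion : ∀ x y, (im x ∪ im y).card = 2 * k - (A x y).card ∧ (A x y).card ≤ k := by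
    intro x y
    have h1 : im y \ im x = (Finset.univ.filter fun f => w y f ∉ im x).image (w y) := by
      ext b
      simp only [im, Finset.mem_sdiff, Finset.mem_image, Finset.mem_univ, true_and,
        Finset.mem_filter]
      constructor
      · rintro ⟨⟨f, rfl⟩, h⟩; exact ⟨f, h, rfl⟩
      · rintro ⟨f, h, rfl⟩; exact ⟨⟨f, rfl⟩, h⟩
    have h2 := Finset.card_filter_add_card_filter_not (s := (Finset.univ : Finset F))
      (fun f => w y f ∈ im x)
    have h3 : (im y \ im x).card = (Finset.univ.filter fun f => w y f ∉ im x).card := by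
      rw [h1, Finset.card_image_of_injective _ (hw y)]
    have h4 := Finset.card_sdiff_add_card (im y) (im x)
    rw [Finset.union_comm] at h4
    rw [Finset.card_univ] at h2
    have h5 := him x
    simp only [A]
    omega
  have hsum2 : ∑ S ∈ P, X S ^ 2 = ∑ x, ∑ y, a (2 * k - (A x y).card) := by
    have : ∀ S, X S ^ 2 = ∑ x, ∑ y, if im x ∪ im y ⊆ S then (1 : ℝ) else 0 := by
      intro S
      simp only [X, sq, Finset.sum_mul_sum]
      refine Finset.sum_congr rfl fun x _ => Finset.sum_congr rfl fun y _ => ?_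
      by_cases h1 : im x ⊆ S <;> by_cases h2 : im y ⊆ S <;> simp [h1, h2, Finset.union_subset_iff]
    simp only [this]
    rw [Finset.sum_comm]
    refine Finset.sum_congr rfl fun x _ => ?_
    rw [Finset.sum_comm]
    refine Finset.sum_congr rfl fun y _ => ?_
    obtain ⟨h1, h2⟩ := hunion x y
    rw [hcount _ (by omega), h1]
  have hpair : ∀ x y, a (2 * k - (A x y).card) * a 0 ≤ a k ^ 2 * T ^ (A x y).card := by
    intro x y
    obtain ⟨-, hi⟩ := hunion x y
    set i := (A x y).card
    have e : 2 * k - i = k + (k - i) := by omega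
    have h1 := choose_sub_add_mul_le hrn k (k - i) (by omega)
    have h2 := choose_sub_le_mul_pow hrn hr0 hr i hi
    rw [ha0, e]
    calc _ ≤ a k * a (k - i) := h1
      _ ≤ a k * (a k * T ^ i) := by gcongr
      _ = _ := by ring
  have hη : ∀ B : Finset F, B.Nonempty → ∀ x,
      ∑ y, (if A x y = B then T ^ B.card else 0) ≤ (k : ℝ) ^ k * (η * N) := by
    intro B hB x
    calc ∑ y, (if A x y = B then T ^ B.card else 0)
        -- A union bound over the maps g recording which face of x carries each shared word; this is
        -- the source of the factor k^k.
        ≤ ∑ y, ∑ g : F → F, (if ∀ f ∈ B, w y f = w x (g f) then T ^ B.card else 0) := by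
          refine Finset.sum_le_sum fun y _ => ?_
          split_ifs with h
          · have : ∀ f, ∃ f', f ∈ B → w y f = w x f' := by
              intro f
              by_cases hf : f ∈ B
              · have hf' := hf
                rw [← h] at hf'
                simp only [A, im, Finset.mem_filter, Finset.mem_univ, true_and,
                  Finset.mem_image] at hf'
                obtain ⟨f', h'⟩ := hf'
                exact ⟨f', fun _ => h'.symm⟩
              · exact ⟨f, fun h => absurd h hf⟩
            choose g hg using this
            refine le_trans ?_ (Finset.single_le_sum (f := fun g : F → F =>
              if ∀ f ∈ B, w y f = w x (g f) then T ^ B.card else 0) ?_ (Finset.mem_univ g))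
            · rw [if_pos fun f hf => hg f hf]
            · intro g _; positivity
          · exact Finset.sum_nonneg fun g _ => by positivity
      _ = ∑ g : F → F, ((Finset.univ.filter fun y => ∀ f ∈ B, w y f = w x (g f)).card : ℝ) *
            T ^ B.card := by
          rw [Finset.sum_comm]
          refine Finset.sum_congr rfl fun g _ => ?_
          rw [← Finset.sum_filter, Finset.sum_const, nsmul_eq_mul]
      _ ≤ ∑ g : F → F, η * N := Finset.sum_le_sum fun g _ => H B hB fun f => w x (g f)
      _ = _ := by simp [hk]
  have hrow : ∀ x, ∑ y, T ^ (A x y).card ≤ N + (2 ^ k - 1) * ((k : ℝ) ^ k * (η * N)) := by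
    intro x
    calc ∑ y, T ^ (A x y).card
        = ∑ y, ∑ B : Finset F, (if A x y = B then T ^ B.card else 0) := by
          refine Finset.sum_congr rfl fun y _ => ?_
          rw [Finset.sum_ite_eq]; simp
      _ = ∑ B : Finset F, ∑ y, (if A x y = B then T ^ B.card else 0) := Finset.sum_comm
      -- Pairs without overlap give the main term N. Each nonempty overlap pattern is controlled by
      -- `hη`; there are fewer than 2^k of them.
      _ = ∑ y, (if A x y = ∅ then T ^ (∅ : Finset F).card else 0) +
            ∑ B ∈ Finset.univ.erase (∅ : Finset F), ∑ y, (if A x y = B then T ^ B.card else 0) := by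
          exact (Finset.add_sum_erase Finset.univ (fun B : Finset F =>
            ∑ y, (if A x y = B then T ^ B.card else 0)) (Finset.mem_univ ∅)).symm
      _ ≤ N + ∑ B ∈ Finset.univ.erase (∅ : Finset F), (k : ℝ) ^ k * (η * N) := by
          gcongr with B hB
          · calc _ ≤ ∑ y : I, (1 : ℝ) := Finset.sum_le_sum fun y _ => by
                  split_ifs <;> simp
              _ = N := by simp [hN]
          · exact hη B (Finset.nonempty_iff_ne_empty.2 (Finset.ne_of_mem_erase hB)) x
      _ = _ := by
          rw [Finset.sum_const, nsmul_eq_mul, Finset.card_erase_of_mem (Finset.mem_univ _),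
            Finset.card_univ, Fintype.card_finset, ← hk, Nat.cast_sub Nat.one_le_two_pow]
          push_cast
          ring
  have hrow' : ∀ x, ∑ y, T ^ (A x y).card ≤ N + 2 ^ k * ((k : ℝ) ^ k * (η * N)) := by
    intro x
    have : 0 ≤ (k : ℝ) ^ k * (η * N) := by positivity
    linarith [hrow x]
  set bad := P.filter fun S => ∀ x, ∃ f, w x f ∉ S
  have hsq : a 0 * ∑ S ∈ P, X S ^ 2 ≤ a k ^ 2 * (N * (N + 2 ^ k * ((k : ℝ) ^ k * (η * N)))) := by
    rw [hsum2, mul_comm, Finset.sum_mul]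
    calc _ ≤ ∑ x : I, a k ^ 2 * (N + 2 ^ k * ((k : ℝ) ^ k * (η * N))) := by
          refine Finset.sum_le_sum fun x _ => ?_
          rw [Finset.sum_mul]
          refine (Finset.sum_le_sum fun y _ => hpair x y).trans ?_
          rw [← Finset.mul_sum]
          gcongr
          exact hrow' x
      _ = _ := by simp [hN]; ring
  have hX0 : ∀ S ∈ bad, X S = 0 := by
    intro S hS
    refine Finset.sum_eq_zero fun x _ => if_neg fun h => ?_
    obtain ⟨f, hf⟩ := (Finset.mem_filter.1 hS).2 x
    exact hf (h (Finset.mem_image_of_mem _ (Finset.mem_univ f)))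
  -- Chebyshev's inequality with denominators cleared: the mean of X over P is N * a k / a 0, and X
  -- vanishes on the bad sets.
  have hcheb : (bad.card : ℝ) * (N * a k) ^ 2 ≤ ∑ S ∈ P, (a 0 * X S - N * a k) ^ 2 := by
    calc (bad.card : ℝ) * (N * a k) ^ 2 = ∑ S ∈ bad, (a 0 * X S - N * a k) ^ 2 := by
          rw [Finset.sum_congr rfl fun S hS => by rw [hX0 S hS], Finset.sum_const, nsmul_eq_mul]
          ring
      _ ≤ _ := Finset.sum_le_sum_of_subset_of_nonneg (Finset.filter_subset _ _)
          fun _ _ _ => sq_nonneg _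
  have hexp : ∑ S ∈ P, (a 0 * X S - N * a k) ^ 2 =
      a 0 * (a 0 * ∑ S ∈ P, X S ^ 2) - a 0 * (N * a k) ^ 2 := by
    calc ∑ S ∈ P, (a 0 * X S - N * a k) ^ 2
        = ∑ S ∈ P, (a 0 ^ 2 * X S ^ 2 - 2 * a 0 * (N * a k) * X S + (N * a k) ^ 2) :=
          Finset.sum_congr rfl fun S _ => by ring
      _ = _ := by
          rw [Finset.sum_add_distrib, Finset.sum_sub_distrib, ← Finset.mul_sum, ← Finset.mul_sum,
            hsum1, Finset.sum_const, nsmul_eq_mul, hPcard]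
          ring
  have hpos : 0 < (N * a k) ^ 2 := by positivity
  have hfin : (bad.card : ℝ) * (N * a k) ^ 2 ≤
      ((2 ^ k * (k : ℝ) ^ k * η) * a 0) * (N * a k) ^ 2 := by
    rw [hexp] at hcheb
    have := mul_le_mul_of_nonneg_left hsq ha0pos.le
    nlinarith
  rw [← ha0]
  exact le_of_mul_le_mul_right hfin hpos

end SecondMoment
-- From exchangeable random subsets to uniform ones
section Exchangeable

theorem exists_perm_image_eq {β : Type*} [Finite β] {S T : Finset β} (h : S.card = T.card) :
    ∃ π : Equiv.Perm β, π '' (S : Set β) = T := by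
  classical
  let e : {x // x ∈ S} ≃ {x // x ∈ T} := Finset.equivOfCardEq h
  refine ⟨e.extendSubtype, ?_⟩
  have hsub : (S.image e.extendSubtype) ⊆ T := by
    intro y hy
    obtain ⟨x, hx, rfl⟩ := Finset.mem_image.1 hy
    exact e.extendSubtype_mem x hx
  have := Finset.eq_of_subset_of_card_le hsub
    (by rw [Finset.card_image_of_injective _ e.extendSubtype.injective, h])
  rw [← Finset.coe_image, this]

open Classical in
/-- For an exchangeable random subset, a property that is rare among the `r`-element subsets for
every admissible `r` is improbable. -/
theorem measureReal_le_of_card_filter_le {β Ω : Type*} [Fintype β] [MeasurableSpace Ω]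
    (P : Measure Ω) [IsProbabilityMeasure P] (R : Ω → Set β)
    (hmeas : ∀ S, MeasurableSet {ω | R ω = S})
    (hinv : ∀ (π : Equiv.Perm β) S, P {ω | R ω = π '' S} = P {ω | R ω = S})
    (good : ℕ → Prop) (bad : Finset β → Prop) (δ : ℝ) (hδ : 0 ≤ δ)
    (H : ∀ r, good r → ((((Finset.univ : Finset β).powersetCard r).filter bad).card : ℝ) ≤
      δ * ((Fintype.card β).choose r : ℝ)) :
    P.real {ω | good (R ω).ncard ∧ bad (R ω).toFinset} ≤ δ := by
  let p : Finset β → ℝ := fun S => P.real {ω | R ω = S}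
  have hp0 : ∀ S, 0 ≤ p S := fun S => measureReal_nonneg
  have hp : ∀ S T : Finset β, S.card = T.card → p S = p T := by
    intro S T h
    obtain ⟨π, hπ⟩ := exists_perm_image_eq h
    simp only [p, measureReal_def, ← hπ, hinv]
  have hdisj : ∀ s : Finset (Finset β),
      (s : Set (Finset β)).PairwiseDisjoint fun S => {ω | R ω = (S : Set β)} := by
    intro s S _ T _ hST
    refine Set.disjoint_left.2 fun ω h1 h2 => hST ?_
    simp only [Set.mem_ofPred_eq] at h1 h2
    exact Finset.coe_injective (h1.symm.trans h2)
  have hsum : ∀ s : Finset (Finset β), P.real (⋃ S ∈ s, {ω | R ω = (S : Set β)}) = ∑ S ∈ s, p S :=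
    fun s => measureReal_biUnion_finset (hdisj s) fun S _ => hmeas S
  have htot : ∑ S, p S ≤ 1 := by
    rw [← hsum]; exact measureReal_le_one
  have heq : {ω | good (R ω).ncard ∧ bad (R ω).toFinset} =
      ⋃ S ∈ Finset.univ.filter fun S : Finset β => good S.card ∧ bad S, {ω | R ω = (S : Set β)} := by
    ext ω
    simp only [Set.mem_ofPred_eq, Finset.mem_filter, Finset.mem_univ, true_and, Set.mem_iUnion,
      exists_prop]
    constructor
    · rintro ⟨h1, h2⟩
      refine ⟨(R ω).toFinset, ⟨?_, h2⟩, by simp⟩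
      rwa [← Set.ncard_eq_toFinset_card']
    · rintro ⟨S, ⟨h1, h2⟩, h3⟩
      rw [h3, Set.ncard_coe_finset, Finset.toFinset_coe]
      exact ⟨h1, h2⟩
  -- Sums over all subsets are grouped by cardinality. Within one cardinality all atoms have equal
  -- mass, so the bad proportion is a ratio of cardinalities.
  rw [heq, hsum, Finset.sum_filter, ← Finset.powerset_univ, Finset.sum_powerset]
  rw [← Finset.powerset_univ, Finset.sum_powerset] at htot
  calc _ ≤ ∑ r ∈ Finset.range ((Finset.univ : Finset β).card + 1),
        δ * ∑ S ∈ (Finset.univ : Finset β).powersetCard r, p S := by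
        refine Finset.sum_le_sum fun r _ => ?_
        by_cases hr : good r
        · rcases ((Finset.univ : Finset β).powersetCard r).eq_empty_or_nonempty with he | ⟨T, hT⟩
          · simp [he]
          have hc : ∀ S ∈ (Finset.univ : Finset β).powersetCard r, p S = p T := fun S hS =>
            hp S T ((Finset.mem_powersetCard.1 hS).2.trans (Finset.mem_powersetCard.1 hT).2.symm)
          calc _ = ∑ S ∈ (Finset.univ : Finset β).powersetCard r, if bad S then p T else 0 := by
                refine Finset.sum_congr rfl fun S hS => ?_
                rw [(Finset.mem_powersetCard.1 hS).2, hc S hS]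
                simp [hr]
            _ = ((((Finset.univ : Finset β).powersetCard r).filter bad).card : ℝ) * p T := by
                rw [← Finset.sum_filter, Finset.sum_const, nsmul_eq_mul]
            _ ≤ (δ * ((Fintype.card β).choose r : ℝ)) * p T :=
                mul_le_mul_of_nonneg_right (H r hr) (hp0 T)
            _ = _ := by
                rw [Finset.sum_congr rfl hc, Finset.sum_const, nsmul_eq_mul,
                  Finset.card_powersetCard, Finset.card_univ]
                ring
        · refine le_trans (le_of_eq (Finset.sum_eq_zero fun S hS => ?_))
            (mul_nonneg hδ (Finset.sum_nonneg fun S _ => hp0 S))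
          rw [(Finset.mem_powersetCard.1 hS).2]
          simp [hr]
    _ = δ * ∑ r ∈ Finset.range ((Finset.univ : Finset β).card + 1),
        ∑ S ∈ (Finset.univ : Finset β).powersetCard r, p S := by rw [Finset.mul_sum]
    _ ≤ δ * 1 := by gcongr
    _ = δ := mul_one δ

end Exchangeable
-- Counting reduced words with prescribed ends
section Words

variable {m : ℕ}

theorem card_not_cancel (x : Fin m × Bool) :
    (Finset.univ.filter fun y : Fin m × Bool => x.1 = y.1 → x.2 = y.2).card = 2 * m - 1 := by
  have : (Finset.univ.filter fun y : Fin m × Bool => x.1 = y.1 → x.2 = y.2) =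
      Finset.univ.erase (x.1, !x.2) := by
    ext ⟨y1, y2⟩
    obtain ⟨x1, x2⟩ := x
    simp only [Finset.mem_filter, Finset.mem_univ, true_and, Finset.mem_erase, ne_eq, Prod.mk.injEq,
      not_and, and_true]
    constructor
    · intro h h1 h2
      have := h h1.symm
      revert this h2
      cases x2 <;> cases y2 <;> simp
    · intro h h1
      have := h h1.symm
      revert this
      cases x2 <;> cases y2 <;> simp
  rw [this, Finset.card_erase_of_mem (Finset.mem_univ _)]
  simp [mul_comm]

theorem card_biUnion_cons {α : Type*} [DecidableEq α] (T : Finset α) (W : α → Finset (List α)) :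
    (T.biUnion fun y => (W y).image (List.cons y)).card = ∑ y ∈ T, (W y).card := by
  rw [Finset.card_biUnion]
  · exact Finset.sum_congr rfl fun y _ =>
      Finset.card_image_of_injective _ (List.cons_injective)
  · intro y _ z _ hyz
    refine Finset.disjoint_left.2 fun l hl hl' => hyz ?_
    obtain ⟨a, -, rfl⟩ := Finset.mem_image.1 hl
    obtain ⟨b, -, hb⟩ := Finset.mem_image.1 hl'
    exact (List.cons.inj hb).1.symm

/-- The first L letters have 2m - 1 choices each; the last letter only has to avoid two
cancellations, which is possible since there are at least four letters. -/
theorem exists_finset_reduced_between (hm : 2 ≤ m) (L : ℕ) (s t : Fin m × Bool) :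
    ∃ W : Finset (Word m), W.card = (2 * m - 1) ^ L ∧
      ∀ w ∈ W, w.length = L + 1 ∧ FreeGroup.IsReduced (s :: w ++ [t]) := by
  induction L generalizing s with
  | zero =>
    obtain ⟨y, hy⟩ : ∃ y, y ∉ ({(s.1, !s.2), (t.1, !t.2)} : Finset (Fin m × Bool)) := by
      by_contra! h
      have h1 := Finset.card_le_card (fun y _ => h y : (Finset.univ : Finset (Fin m × Bool)) ⊆ _)
      have h2 : ({(s.1, !s.2), (t.1, !t.2)} : Finset (Fin m × Bool)).card ≤ 2 :=
        Finset.card_le_two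
      simp at h1
      omega
    refine ⟨{[y]}, by simp, ?_⟩
    simp only [Finset.mem_insert, Finset.mem_singleton, not_or] at hy
    obtain ⟨s1, s2⟩ := s
    obtain ⟨t1, t2⟩ := t
    obtain ⟨y1, y2⟩ := y
    simp only [Prod.mk.injEq, not_and, Bool.not_eq_not] at hy
    simp only [Finset.mem_singleton, forall_eq, List.length_singleton, zero_add, true_and]
    simp only [FreeGroup.IsReduced, List.cons_append, List.nil_append, List.isChain_cons_cons,
      List.isChain_singleton, and_true]
    exact ⟨fun h => by have := hy.1 h.symm; cases s2 <;> cases y2 <;> simp_all,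
      fun h => by have := hy.2 h; cases t2 <;> cases y2 <;> simp_all⟩
  | succ L ih =>
    choose W hW1 hW2 using ih
    refine ⟨(Finset.univ.filter fun y : Fin m × Bool => s.1 = y.1 → s.2 = y.2).biUnion
      fun y => (W y).image (List.cons y), ?_, ?_⟩
    · rw [card_biUnion_cons, Finset.sum_congr rfl fun y _ => hW1 y, Finset.sum_const,
        card_not_cancel, smul_eq_mul, pow_succ, mul_comm]
    · intro w hw
      obtain ⟨y, hy, hw⟩ := Finset.mem_biUnion.1 hw
      obtain ⟨w, hw', rfl⟩ := Finset.mem_image.1 hw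
      obtain ⟨h1, h2⟩ := hW2 y w hw'
      refine ⟨by simp [h1], ?_⟩
      simp only [FreeGroup.IsReduced, List.cons_append, List.isChain_cons_cons] at h2 ⊢
      exact ⟨(Finset.mem_filter.1 hy).2, h2⟩

theorem exists_finset_reduced_after (L : ℕ) (s : Fin m × Bool) :
    ∃ W : Finset (Word m), W.card ≤ (2 * m - 1) ^ L ∧
      ∀ w : Word m, w.length = L → FreeGroup.IsReduced (s :: w) → w ∈ W := by
  induction L generalizing s with
  | zero => exact ⟨{[]}, by simp, fun w hw _ => by simpa using hw⟩
  | succ L ih =>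
    choose W hW1 hW2 using ih
    refine ⟨(Finset.univ.filter fun y : Fin m × Bool => s.1 = y.1 → s.2 = y.2).biUnion
      fun y => (W y).image (List.cons y), ?_, ?_⟩
    · rw [card_biUnion_cons]
      refine (Finset.sum_le_sum fun y _ => hW1 y).trans ?_
      rw [Finset.sum_const, card_not_cancel, smul_eq_mul, pow_succ, mul_comm]
    · intro w hw hr
      obtain _ | ⟨y, w⟩ := w
      · simp at hw
      simp only [FreeGroup.IsReduced, List.isChain_cons_cons] at hr
      exact Finset.mem_biUnion.2 ⟨y, by simpa using hr.1,
        Finset.mem_image_of_mem _ (hW2 y w (by simpa using hw) hr.2)⟩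

theorem exists_finset_reduced (hm : 2 ≤ m) (n : ℕ) :
    ∃ W : Finset (Word m), W.card ≤ 2 * (2 * m - 1) ^ n ∧
      ∀ w : Word m, w.length = n → FreeGroup.IsReduced w → w ∈ W := by
  obtain _ | L := n
  · exact ⟨{[]}, by simp, fun w hw _ => by simpa using hw⟩
  choose W hW1 hW2 using exists_finset_reduced_after (m := m) L
  refine ⟨Finset.univ.biUnion fun y => (W y).image (List.cons y), ?_, ?_⟩
  · rw [card_biUnion_cons]
    refine (Finset.sum_le_sum fun y _ => hW1 y).trans ?_
    rw [Finset.sum_const, Finset.card_univ, smul_eq_mul, pow_succ]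
    simp only [Fintype.card_prod, Fintype.card_fin, Fintype.card_bool]
    calc m * 2 * (2 * m - 1) ^ L ≤ (2 * (2 * m - 1)) * (2 * m - 1) ^ L :=
          Nat.mul_le_mul_right _ (by omega)
      _ = _ := by ring
  · intro w hw hr
    obtain _ | ⟨y, w⟩ := w
    · simp at hw
    exact Finset.mem_biUnion.2 ⟨y, Finset.mem_univ _,
      Finset.mem_image_of_mem _ (hW2 y w (by simpa using hw) hr)⟩

/-- A geometric sum: since 2m - 1 ≥ 3, the bound 3(2m - 1)^k reproduces itself when the next term
2(2m - 1)^(k+1) is added. -/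
theorem card_B_le (hm : 2 ≤ m) (ℓ : ℕ) : Nat.card (B m ℓ) ≤ 3 * (2 * m - 1) ^ ℓ := by
  choose W hW1 hW2 using exists_finset_reduced hm
  have hsub : {w : Word m | FreeGroup.IsCyclicallyReduced w ∧ w.length ≤ ℓ} ⊆
      ((Finset.range (ℓ + 1)).biUnion W : Finset (Word m)) := by
    intro w hw
    refine Finset.mem_coe.2 (Finset.mem_biUnion.2 ⟨w.length, ?_, hW2 _ w rfl hw.1.1⟩)
    have := hw.2
    simp; omega
  have h1 := Set.ncard_le_ncard hsub (Finset.finite_toSet _)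
  rw [Set.ncard_coe_finset] at h1
  have h2 : ∀ k, ∑ j ∈ Finset.range (k + 1), 2 * (2 * m - 1) ^ j ≤ 3 * (2 * m - 1) ^ k := by
    intro k
    induction k with
    | zero => simp
    | succ k ih =>
      rw [Finset.sum_range_succ]
      have h3 : 3 * (2 * m - 1) ^ k ≤ (2 * m - 1) ^ (k + 1) := by
        rw [pow_succ, mul_comm]
        exact Nat.mul_le_mul_left _ (by omega)
      omega
  calc Nat.card (B m ℓ) = Set.ncard {w : Word m | FreeGroup.IsCyclicallyReduced w ∧ w.length ≤ ℓ} :=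
        Nat.card_coe_set_eq _
    _ ≤ _ := h1
    _ ≤ ∑ j ∈ Finset.range (ℓ + 1), (W j).card := Finset.card_biUnion_le
    _ ≤ ∑ j ∈ Finset.range (ℓ + 1), 2 * (2 * m - 1) ^ j := Finset.sum_le_sum fun j _ => hW1 j
    _ ≤ _ := h2 ℓ

/-- The powers of a single letter already suffice. The bound makes |B_ℓ| tend to infinity. -/
theorem lt_card_B (hm : 2 ≤ m) (ℓ : ℕ) : ℓ < Nat.card (B m ℓ) := by
  let x : Fin m × Bool := (⟨0, by omega⟩, true)
  let φ : Fin (ℓ + 1) → B m ℓ := fun j => ⟨List.replicate j x, by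
    refine ⟨⟨List.isChain_replicate_of_rel _ fun _ => rfl, ?_⟩, by simp; omega⟩
    intro a ha b hb _
    rw [List.eq_of_mem_replicate (List.mem_of_mem_getLast? ha),
      List.eq_of_mem_replicate (List.mem_of_mem_head? hb)]⟩
  have hφ : Function.Injective φ := by
    intro i j h
    have := congrArg (fun w : B m ℓ => w.1.length) h
    simpa [φ, Fin.ext_iff] using this
  have := Nat.card_le_card_of_injective φ hφ
  simp at this
  omega

theorem isReduced_invRev {w : Word m} (h : FreeGroup.IsReduced w) :
    FreeGroup.IsReduced (FreeGroup.invRev w) := by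
  rw [FreeGroup.isReduced_iff_reduce_eq] at h ⊢
  rw [FreeGroup.reduce_invRev, h]

/-- A free group has no element of order two. -/
theorem ne_invRev {w : Word m} (h : FreeGroup.IsReduced w) (h0 : w ≠ []) :
    w ≠ FreeGroup.invRev w := by
  intro he
  have h1 : FreeGroup.mk w = (FreeGroup.mk w)⁻¹ := by
    rw [FreeGroup.inv_mk, ← he]
  have h2 : FreeGroup.mk w = 1 := self_eq_inv.1 h1
  have h3 := congrArg FreeGroup.toWord h2
  rw [FreeGroup.toWord_mk, FreeGroup.toWord_one, h.reduce_eq] at h3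
  exact h0 h3

/-- Reduced words of length `n` that begin with `c` and whose inverses begin with `c'`. -/
def edgeWords (m n : ℕ) (c c' : Word m) : Set (Word m) :=
  {u | u.length = n ∧ FreeGroup.IsReduced u ∧ c <+: u ∧ c' <+: FreeGroup.invRev u}

instance (n : ℕ) (c c' : Word m) : Finite (edgeWords m n c c') :=
  ((List.finite_length_eq (Fin m × Bool) n).subset fun _ hw => hw.1).to_subtype

theorem card_edgeWords_le (hm : 2 ≤ m) (n : ℕ) (c c' : Word m) :
    Nat.card (edgeWords m n c c') ≤ 2 * (2 * m - 1) ^ n := by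
  obtain ⟨W, h1, h2⟩ := exists_finset_reduced hm n
  rw [Nat.card_coe_set_eq]
  refine le_trans ?_ h1
  rw [← Set.ncard_coe_finset]
  exact Set.ncard_le_ncard (fun w hw => h2 w hw.1 hw.2.1) (Finset.finite_toSet _)

/-- The word starts with c and ends with the inverse of c'. The n - 2q letters between them are free
except for the last one, which bridges to the suffix. -/
theorem le_card_edgeWords (hm : 2 ≤ m) {n q : ℕ} {c c' : Word m} (hc : FreeGroup.IsReduced c)
    (hc' : FreeGroup.IsReduced c') (hq : c.length = q) (hq' : c'.length = q) (hq0 : 0 < q)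
    (hn : 2 * q + 1 ≤ n) : (2 * m - 1) ^ (n - (2 * q + 1)) ≤ Nat.card (edgeWords m n c c') := by
  obtain ⟨c0, s, rfl⟩ := (List.eq_nil_or_concat c).resolve_left (by rintro rfl; simp at hq; omega)
  rw [List.concat_eq_append] at hc hq ⊢
  have hr' := isReduced_invRev hc'
  have hl' : (FreeGroup.invRev c').length = q := by simp [hq']
  obtain ⟨t, t0, ht⟩ := List.exists_cons_of_ne_nil (l := FreeGroup.invRev c')
    (by intro h; rw [h] at hl'; simp at hl'; omega)
  rw [ht] at hr' hl'
  obtain ⟨W, h1, h2⟩ := exists_finset_reduced_between hm (n - (2 * q + 1)) s t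
  rw [← h1, Nat.card_coe_set_eq, ← Set.ncard_coe_finset]
  refine Set.ncard_le_ncard_of_injOn (fun w => (c0 ++ [s]) ++ (w ++ t :: t0)) ?_ ?_
    (Set.toFinite _)
  · intro w hw
    obtain ⟨h3, h4⟩ := h2 w hw
    refine ⟨?_, ?_, List.prefix_append _ _, ?_⟩
    · simp at hq hl' ⊢; omega
    · have h5 : FreeGroup.IsReduced ([s] ++ w ++ (t :: t0)) := by
        have := FreeGroup.IsReduced.append_overlap (L₁ := [s] ++ w) (L₂ := [t]) (L₃ := t0)
          (by simpa using h4) (by simpa using hr') (by simp)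
        simpa using this
      have := FreeGroup.IsReduced.append_overlap (L₁ := c0) (L₂ := [s]) (L₃ := w ++ (t :: t0))
        hc (by simpa using h5) (by simp)
      simpa using this
    · rw [← ht]
      refine ⟨FreeGroup.invRev w ++ FreeGroup.invRev (c0 ++ [s]), ?_⟩
      simp only [FreeGroup.invRev_append, FreeGroup.invRev_invRev, List.append_assoc]
  · intro w _ w' _ h
    exact List.append_cancel_right (List.append_cancel_left h)

/-- Finitely many letters extend to distinct reduced words of the same length. -/
theorem exists_prefix_code (hm : 2 ≤ m) {δ : Type*} [Finite δ] (col : δ → Fin m × Bool) :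
    ∃ q : ℕ, 0 < q ∧ ∃ c : δ → Word m, Function.Injective c ∧
      ∀ a, (c a).length = q ∧ FreeGroup.IsReduced (c a) ∧ (c a).head? = some (col a) := by
  obtain ⟨N, ⟨e⟩⟩ := Finite.exists_equiv_fin δ
  have : ∀ x : Fin m × Bool, ∃ z : Fin m × Bool, z.1 ≠ x.1 := fun x => by
    have : Nontrivial (Fin m) := Fin.nontrivial_iff_two_le.2 hm
    obtain ⟨z, hz⟩ := exists_ne x.1
    exact ⟨(z, true), hz⟩
  choose z hz using this
  have hz' : ∀ x, z x ≠ x := fun x h => hz x (by rw [h])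
  -- A run of `col a` of length e a + 1, padded by a letter over another generator. The first letter
  -- gives the colour and the length of the run then gives a.
  refine ⟨N + 1, Nat.succ_pos _, fun a => List.replicate (e a + 1) (col a) ++
    List.replicate (N - e a) (z (col a)), ?_, ?_⟩
  · intro a b h
    have h1 : col a = col b := by
      have := congrArg List.head? h
      simpa [List.replicate_succ] using this
    have h2 := congrArg (List.count (col a)) h
    simp only [List.count_append, ← h1, List.count_replicate_self] at h2
    rw [List.count_replicate, List.count_replicate] at h2
    simp [hz'] at h2
    exact e.injective (Fin.ext h2)
  · intro a
    have := (e a).2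
    refine ⟨by simp; omega, ?_, by simp [List.replicate_succ]⟩
    refine List.isChain_append.2 ⟨List.isChain_replicate_of_rel _ fun _ => rfl,
      List.isChain_replicate_of_rel _ fun _ => rfl, ?_⟩
    intro x hx y hy h
    rw [List.eq_of_mem_replicate (List.mem_of_mem_getLast? hx),
      List.eq_of_mem_replicate (List.mem_of_mem_head? hy)] at h
    exact absurd h.symm (hz _)

end Words
-- Consequences of planarity: corners, distinct faces, edge count
section Planar

theorem cycleChain_and {α : Type*} {r s : α → α → Prop} {l : List α}
    (h1 : Cycle.Chain r (l : Cycle α)) (h2 : Cycle.Chain s (l : Cycle α)) :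
    Cycle.Chain (fun a b => r a b ∧ s a b) (l : Cycle α) := by
  obtain _ | ⟨a, t⟩ := l
  · exact Cycle.Chain.nil _
  rw [Cycle.chain_coe_cons, List.isChain_iff_forall_rel_of_append_cons_cons] at *
  exact fun a b l₁ l₂ h => ⟨h1 h, h2 h⟩

theorem cycleChain_invRev {α : Type*} {r : α × Bool → α × Bool → Prop} {l : List (α × Bool)}
    (h : Cycle.Chain (fun a b => r (b.1, !b.2) (a.1, !a.2)) (l : Cycle (α × Bool))) :
    Cycle.Chain r (FreeGroup.invRev l : Cycle (α × Bool)) := by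
  obtain _ | ⟨a, t⟩ := l
  · exact Cycle.Chain.nil _
  have e : ((FreeGroup.invRev (a :: t) : List (α × Bool)) : Cycle (α × Bool)) =
      (((a.1, !a.2) :: FreeGroup.invRev t : List (α × Bool)) : Cycle (α × Bool)) := by
    rw [FreeGroup.invRev_cons]
    exact Cycle.coe_eq_coe.2 (List.isRotated_append)
  rw [e, Cycle.chain_coe_cons]
  rw [Cycle.chain_coe_cons] at h
  have e2 : ((a.1, !a.2) :: (FreeGroup.invRev t ++ [(a.1, !a.2)])) =
      ((a :: (t ++ [a])).map fun x => (x.1, !x.2)).reverse := by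
    simp [FreeGroup.invRev]
  rw [e2, List.isChain_reverse, List.isChain_map]
  exact h

theorem cycleChain_exists_next {α : Type*} {r : α → α → Prop} {l : List α}
    (h : Cycle.Chain r (l : Cycle α)) {a : α} (ha : a ∈ l) : ∃ b ∈ l, r a b := by
  obtain _ | ⟨x, t⟩ := l
  · simp at ha
  rw [Cycle.chain_coe_cons, List.isChain_iff_forall_rel_of_append_cons_cons] at h
  obtain ⟨p, q, hpq⟩ := List.append_of_mem ha
  obtain _ | ⟨y, q⟩ := q
  · exact ⟨x, by simp, h (l₁ := p) (l₂ := []) (by rw [← List.cons_append, hpq]; simp)⟩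
  · exact ⟨y, by rw [hpq]; simp, h (l₁ := p) (l₂ := q ++ [x]) (by rw [← List.cons_append, hpq]; simp)⟩

/-- The cycles of a permutation can be coloured properly with three colours. -/
theorem exists_coloring_perm {α κ : Type*} [Finite α] [Fintype κ] (hκ : 3 ≤ Fintype.card κ)
    (σ : Equiv.Perm α) : ∃ col : α → κ, ∀ x, σ x ≠ x → col x ≠ col (σ x) := by
  classical
  cases nonempty_fintype α
  have : Nonempty κ := Fintype.card_pos_iff.1 (by omega)
  suffices h : ∀ s : Finset α, ∃ col : α → κ, ∀ x ∈ s, σ x ∈ s → σ x ≠ x → col x ≠ col (σ x) by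
    obtain ⟨col, h⟩ := h Finset.univ
    exact ⟨col, fun x => h x (Finset.mem_univ _) (Finset.mem_univ _)⟩
  intro s
  induction s using Finset.induction_on with
  | empty => exact ⟨fun _ => Classical.arbitrary κ, by simp⟩
  | insert a s ha ih =>
    obtain ⟨col, hcol⟩ := ih
    -- Greedy colouring: a new point has at most two neighbours, its image and its preimage, so one
    -- of three colours is free.
    obtain ⟨z, hz⟩ : ∃ z, z ∉ ({col (σ a), col (σ.symm a)} : Finset κ) := by
      by_contra! h
      have h1 := Finset.card_le_card (fun y _ => h y : (Finset.univ : Finset κ) ⊆ _)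
      have h2 : ({col (σ a), col (σ.symm a)} : Finset κ).card ≤ 2 := Finset.card_le_two
      rw [Finset.card_univ] at h1
      omega
    simp only [Finset.mem_insert, Finset.mem_singleton, not_or] at hz
    refine ⟨Function.update col a z, fun x hx hσx hne => ?_⟩
    by_cases hxa : x = a
    · subst hxa
      rw [Function.update_self, Function.update_of_ne hne]
      exact hz.1
    · by_cases hσ : σ x = a
      · have : x = σ.symm a := by rw [← hσ]; simp
        rw [Function.update_of_ne hxa, hσ, Function.update_self, this]
        exact fun h => hz.2 h.symm
      · rw [Function.update_of_ne hxa, Function.update_of_ne hσ]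
        exact hcol x (Finset.mem_of_mem_insert_of_ne hx hxa)
          (Finset.mem_of_mem_insert_of_ne hσx hσ) hne

namespace TwoComplex

variable {D : TwoComplex}

/-- The letters at the corners of a planar complex can be chosen so that no corner cancels. -/
theorem IsPlanar.exists_corner_coloring (hD : D.IsPlanar) {κ : Type*} [Fintype κ]
    (hκ : 3 ≤ Fintype.card κ) : ∃ col : D.Dart → κ, ∀ f,
      Cycle.Chain (fun a b => col (a.1, !a.2) ≠ col b) (D.bdry f : Cycle D.Dart) := by
  obtain ⟨σ, -, -, o, ho, -⟩ := hD
  have : Finite D.Dart := inferInstanceAs (Finite (D.E × Bool))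
  obtain ⟨col, hcol⟩ := exists_coloring_perm hκ σ
  refine ⟨col, fun f => ?_⟩
  -- At a corner where b follows a, face tracing makes b and the inverse of a consecutive under σ;
  -- which comes first depends on the orientation `o f`. They are distinct because the loop is
  -- reduced, so their colours differ.
  have h1 := (ho f).2
  have h2 := (D.isReducedLoop_bdry f).2
  rcases hof : o f with _ | _
  · have e : D.orientedBdry (f, o f) = FreeGroup.invRev (D.bdry f) := by simp [orientedBdry, hof]
    rw [e] at h1
    have h3 : Cycle.Chain (fun a b => D.trace σ (b.1, !b.2) = (a.1, !a.2)) (D.bdry f : Cycle D.Dart) := by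
      rw [← FreeGroup.invRev_invRev (L₁ := D.bdry f)]
      refine cycleChain_invRev ?_
      simpa using h1
    refine Cycle.Chain.imp ?_ (cycleChain_and h3 h2)
    rintro ⟨a1, a2⟩ ⟨b1, b2⟩ ⟨h3, -, h4⟩
    simp only [FinGraph.trace, FinGraph.flip, Equiv.Perm.coe_mul, Function.comp_apply,
      Equiv.coe_fn_mk, Bool.not_not] at h3
    simp only [← h3]
    refine (hcol _ ?_).symm
    rw [h3]
    intro h
    simp only [Prod.mk.injEq] at h
    have := h4 h.1
    simp_all
  · have e : D.orientedBdry (f, o f) = D.bdry f := by simp [orientedBdry, hof]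
    rw [e] at h1
    refine Cycle.Chain.imp ?_ (cycleChain_and h1 h2)
    rintro ⟨a1, a2⟩ ⟨b1, b2⟩ ⟨h3, -, h4⟩
    simp only [FinGraph.trace, FinGraph.flip, Equiv.Perm.coe_mul, Function.comp_apply,
      Equiv.coe_fn_mk] at h3
    simp only [← h3]
    refine hcol _ ?_
    rw [h3]
    intro h
    simp only [Prod.mk.injEq] at h
    have := h4 h.1.symm
    simp_all

theorem orientedBdry_ne_nil (f : D.F × Bool) : D.orientedBdry f ≠ [] := by
  have := (D.isReducedLoop_bdry f.1).1
  unfold orientedBdry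
  split_ifs
  · exact this
  · intro h
    exact this (by rw [← FreeGroup.invRev_invRev (L₁ := D.bdry f.1), h]; rfl)

theorem orientedBdry_not (f : D.F) (b : Bool) :
    D.orientedBdry (f, !b) = FreeGroup.invRev (D.orientedBdry (f, b)) := by
  cases b <;> simp [orientedBdry, FreeGroup.invRev_invRev]

theorem mem_invRev {α : Type*} {l : List (α × Bool)} {a : α × Bool} :
    a ∈ FreeGroup.invRev l ↔ (a.1, !a.2) ∈ l := by
  obtain ⟨a1, a2⟩ := a
  simp only [FreeGroup.invRev, List.mem_reverse, List.mem_map, Prod.mk.injEq, Prod.exists]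
  constructor
  · rintro ⟨x, y, h, rfl, rfl⟩; simpa using h
  · exact fun h => ⟨a1, !a2, h, rfl, by simp⟩

/-- Two faces of a planar complex do not have the same boundary, even after inversion. -/
theorem IsPlanar.bdry_ne (hD : D.IsPlanar) {f g : D.F} (hfg : f ≠ g) :
    D.bdry f ≠ D.bdry g ∧ D.bdry f ≠ FreeGroup.invRev (D.bdry g) := by
  obtain ⟨σ, hrot, -, o, ho, hdisj, hout⟩ := hD
  have : Finite D.Dart := inferInstanceAs (Finite (D.E × Bool))
  have hne : ¬ D.orientedBdry (f, o f) = D.orientedBdry (g, o g) := by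
    intro h
    obtain ⟨a, ha⟩ := List.exists_mem_of_ne_nil _ (orientedBdry_ne_nil (f, o f))
    exact hdisj f g hfg ha (h ▸ ha)
  have hne' : ¬ D.orientedBdry (f, o f) = D.orientedBdry (g, !(o g)) := by
    -- If two faces had opposite boundaries, their oriented edges would be closed under reversal and
    -- face tracing, hence under σ. They would then exhaust a component and leave no region for the
    -- point at infinity.
    intro h
    rw [orientedBdry_not] at h
    have hnext : ∀ k a, a ∈ D.orientedBdry (k, o k) → D.trace σ a ∈ D.orientedBdry (k, o k) := by
      intro k a ha
      obtain ⟨b, hb, rfl⟩ := cycleChain_exists_next (ho k).2 ha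
      exact hb
    let T : Set D.Dart := {a | a ∈ D.orientedBdry (f, o f) ∨ a ∈ D.orientedBdry (g, o g)}
    have hflip : ∀ a ∈ T, D.flip a ∈ T := by
      have hmem : ∀ a, a ∈ D.orientedBdry (f, o f) ↔ D.flip a ∈ D.orientedBdry (g, o g) := by
        intro a
        rw [h, mem_invRev]; rfl
      have hff : ∀ a, D.flip (D.flip a) = a := fun a => by simp [FinGraph.flip]
      rintro a (ha | ha)
      · exact Or.inr ((hmem a).1 ha)
      · exact Or.inl ((hmem _).2 (by rwa [hff]))
    have htrace : ∀ a ∈ T, D.trace σ a ∈ T := by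
      rintro a (ha | ha)
      · exact Or.inl (hnext f a ha)
      · exact Or.inr (hnext g a ha)
    have hσ : ∀ a ∈ T, σ a ∈ T := by
      intro a ha
      have := htrace _ (hflip a ha)
      simpa [FinGraph.trace, FinGraph.flip] using this
    have hpow : ∀ (i : ℕ), ∀ a ∈ T, (σ ^ i) a ∈ T := by
      intro i
      induction i with
      | zero => exact fun a ha => by simpa using ha
      | succ i ih => exact fun a ha => by rw [pow_succ']; exact hσ _ (ih a ha)
    have hinit : ∀ a b, D.init a = D.init b → a ∈ T → b ∈ T := by
      intro a b hab ha
      obtain ⟨i, rfl⟩ := ((hrot a b).2 hab).exists_nat_pow_eq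
      exact hpow i a ha
    let V : D.V → Prop := fun v => ∃ a ∈ T, D.init a = v
    have hstep : ∀ x : D.Dart, V (D.init x) → V (D.term x) := by
      rintro x ⟨a, ha, hax⟩
      refine ⟨D.flip x, hflip x (hinit a x hax ha), ?_⟩
      cases hx : x.2 <;> simp [FinGraph.init, FinGraph.term, FinGraph.flip, hx]
    have hstep' : ∀ x : D.Dart, V (D.init x) ↔ V (D.term x) := by
      refine fun x => ⟨hstep x, fun hx => ?_⟩
      have := hstep (D.flip x)
      cases hx2 : x.2 <;> simp_all [FinGraph.init, FinGraph.term, FinGraph.flip]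
    let p : D.Component → Prop := Quot.lift V fun v w ⟨a, hv, hw⟩ => by
      rw [← hv, ← hw]; exact propext (hstep' a)
    obtain ⟨a, ha⟩ := List.exists_mem_of_ne_nil _ (orientedBdry_ne_nil (f, o f))
    obtain ⟨b, hb, hb'⟩ := hout a
    have hpa : p (D.component (D.init a)) := ⟨a, Or.inl ha, rfl⟩
    rw [← hb] at hpa
    obtain ⟨c, hc, hcb⟩ := hpa
    rcases hinit c b hcb hc with h | h
    · exact hb' _ h
    · exact hb' _ h
  constructor <;> intro h <;> rcases hf : o f with _ | _ <;> rcases hg : o g with _ | _ <;>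
    simp_all [orientedBdry, FreeGroup.invRev_invRev]

/-- The sub-2-complex of a set of faces. -/
def closure (A : Set D.F) : D.Sub where
  verts := Set.univ
  edges := {e | ∃ f ∈ A, ∃ a ∈ D.bdry f, a.1 = e}
  faces := A
  src_mem := fun _ _ => Set.mem_univ _
  tgt_mem := fun _ _ => Set.mem_univ _
  bdry_mem := fun f hf a ha => ⟨f, hf, a, ha, rfl⟩

theorem ncard_edges_closure_singleton_le (f : D.F) :
    (closure {f}).edges.ncard ≤ (D.bdry f).length := by
  classical
  have : (closure {f}).edges = (((D.bdry f).map Prod.fst).toFinset : Set D.E) := by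
    ext e; simp [closure]
  rw [this, Set.ncard_coe_finset]
  exact (List.toFinset_card_le _).trans (by simp)

/-- With the orientations `o`, the face boundaries are disjoint and without repetition, so each of
the two oriented edges over e is traversed at most once. -/
theorem IsPlanar.adjacency_le (hD : D.IsPlanar) (Z : D.Sub) (e : D.E) : Z.adjacency e ≤ 2 := by
  obtain ⟨σ, -, -, o, ho, hdisj, -⟩ := hD
  have hnd : ∀ f, (D.bdry f).Nodup := by
    intro f
    have := (ho f).1
    unfold orientedBdry at this
    split_ifs at this
    · exact this
    · refine List.Nodup.of_map (fun x : D.E × Bool => (x.1, !x.2)) ?_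
      exact List.nodup_reverse.1 this
  have hmem : ∀ f b, (e, b) ∈ D.bdry f → (e, b == o f) ∈ D.orientedBdry (f, o f) := by
    intro f b h
    rcases hof : o f with _ | _
    · simp only [orientedBdry]
      rw [if_neg (by simp), mem_invRev]
      cases b <;> simpa using h
    · simp only [orientedBdry]
      cases b <;> simpa using h
  let s : Set (D.F × ℕ) := {p | p.1 ∈ Z.faces ∧ ∃ b : Bool, (D.bdry p.1)[p.2]? = some (e, b)}
  -- The direction in which a passage traverses e once its face is oriented by `o`. The default
  -- `true` is never used on s.
  let φ : D.F × ℕ → Bool := fun p =>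
    (((D.bdry p.1)[p.2]?).map Prod.snd).getD true == o p.1
  have hφ : Set.InjOn φ s := by
    rintro ⟨f, i⟩ ⟨-, b, hb⟩ ⟨g, j⟩ ⟨-, c, hc⟩ h
    simp only at hb hc
    simp only [φ, hb, hc, Option.map_some, Option.getD_some] at h
    have h1 := hmem f b (List.mem_of_getElem? hb)
    have h2 := hmem g c (List.mem_of_getElem? hc)
    rw [h] at h1
    have hfg : f = g := by
      by_contra hfg
      exact hdisj f g hfg h1 h2
    subst hfg
    have hbc : b = c := by revert h; cases b <;> cases c <;> cases o f <;> simp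
    subst hbc
    obtain ⟨hi, hb'⟩ := List.getElem?_eq_some_iff.1 hb
    obtain ⟨hj, hc'⟩ := List.getElem?_eq_some_iff.1 hc
    have := (hnd f).getElem_inj_iff.1 (hb'.trans hc'.symm)
    rw [this]
  have := Set.ncard_le_ncard_of_injOn (t := Set.univ) φ (fun _ _ => Set.mem_univ _) hφ
  rw [Set.ncard_univ] at this
  change s.ncard ≤ 2
  simpa using this

theorem sum_adjacency [Fintype D.F] [Fintype D.E] (Z : D.Sub) (A : Finset D.F)
    (EZ : Finset D.E) (hA : (A : Set D.F) = Z.faces) (hE : (EZ : Set D.E) = Z.edges) :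
    ∑ e ∈ EZ, Z.adjacency e = ∑ f ∈ A, (D.bdry f).length := by
  classical
  let s : Finset (Σ f : D.F, Fin (D.bdry f).length) := A.sigma fun _ => Finset.univ
  let φ : (Σ f : D.F, Fin (D.bdry f).length) → D.E := fun p => ((D.bdry p.1)[p.2]).1
  have h1 : s.card = ∑ f ∈ A, (D.bdry f).length := by simp [s]
  have h2 : s.card = ∑ e ∈ EZ, (s.filter fun p => φ p = e).card := by
    refine Finset.card_eq_sum_card_fiberwise fun p hp => ?_
    rw [hE]
    refine Z.bdry_mem p.1 ?_ _ (List.getElem_mem _)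
    rw [← hA]
    exact Finset.mem_coe.2 (Finset.mem_sigma.1 hp).1
  rw [← h1, h2]
  refine Finset.sum_congr rfl fun e _ => ?_
  rw [Sub.adjacency, ← Set.ncard_coe_finset]
  symm
  refine Set.ncard_congr (fun p _ => (p.1, (p.2 : ℕ))) ?_ ?_ ?_
  · intro p hp
    obtain ⟨hp1, hp2⟩ := Finset.mem_filter.1 (Finset.mem_coe.1 hp)
    refine ⟨?_, ((D.bdry p.1)[p.2]).2, ?_⟩
    · rw [← hA]; exact Finset.mem_coe.2 (Finset.mem_sigma.1 hp1).1
    · rw [← hp2]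
      simp [φ]
  · rintro ⟨f, i⟩ ⟨g, j⟩ - - h
    simp only [Prod.mk.injEq] at h
    obtain ⟨rfl, h⟩ := h
    rw [Fin.ext h]
  · rintro ⟨f, i⟩ ⟨hf, b, hb⟩
    obtain ⟨hi, hb'⟩ := List.getElem?_eq_some_iff.1 hb
    refine ⟨⟨f, ⟨i, hi⟩⟩, ?_, rfl⟩
    refine Finset.mem_coe.2 (Finset.mem_filter.2 ⟨Finset.mem_sigma.2 ⟨?_, Finset.mem_univ _⟩, ?_⟩)
    · rw [← hA] at hf; exact hf
    · simp only [φ]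
      exact congrArg Prod.fst hb'

/-- Double counting of the passages of the faces through the edges. -/
theorem IsPlanar.two_mul_ncard_edges (hD : D.IsPlanar) (Z : D.Sub) [Fintype D.F] (A : Finset D.F)
    (hA : (A : Set D.F) = Z.faces) :
    2 * Z.edges.ncard = ∑ f ∈ A, (D.bdry f).length + Z.bdryLength := by
  classical
  cases nonempty_fintype D.E
  have hE : (Z.edges.toFinset : Set D.E) = Z.edges := by simp
  rw [← sum_adjacency Z A Z.edges.toFinset hA hE, Sub.bdryLength]
  have e0 : ∀ k, {e ∈ Z.edges | Z.adjacency e = k}.ncard =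
      ∑ e ∈ Z.edges.toFinset, if Z.adjacency e = k then 1 else 0 := by
    intro k
    rw [Finset.sum_boole, Nat.cast_id, ← Set.ncard_coe_finset]
    congr 1
    ext e; simp
  rw [e0, e0, Finset.mul_sum, ← Finset.sum_add_distrib, ← Finset.sum_add_distrib,
    Set.ncard_eq_toFinset_card' Z.edges, mul_comm, ← smul_eq_mul, ← Finset.sum_const]
  -- Edge by edge: adjacency 2, 1 or 0 is completed to 2 by a boundary contribution of 0, 1 or 2.
  refine Finset.sum_congr rfl fun e _ => ?_
  have := hD.adjacency_le Z e
  split_ifs <;> omega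

end TwoComplex

end Planar
-- Labelings of the divided edges and their face words
section Labelings

/-- Two cyclically consecutive letters lie either in one block or across the junction of two
consecutive blocks, blocks being nonempty. -/
theorem cycleChain_flatMap {α β : Type*} {r : β → β → Prop} {W : α → List β}
    (hW : ∀ a, W a ≠ []) (l : List α) :
    Cycle.Chain r (l.flatMap W : Cycle β) ↔ (∀ a ∈ l, (W a).IsChain r) ∧
      Cycle.Chain (fun a b => ∀ x ∈ (W a).getLast?, ∀ y ∈ (W b).head?, r x y) (l : Cycle α) := by
  obtain _ | ⟨a, t⟩ := l
  · simp
  have key : ((a :: (t ++ [a])).flatMap W).IsChain r ↔ (∀ c ∈ a :: t, (W c).IsChain r) ∧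
      Cycle.Chain (fun a b => ∀ x ∈ (W a).getLast?, ∀ y ∈ (W b).head?, r x y)
        ((a :: t : List α) : Cycle α) := by
    rw [List.flatMap_def, List.isChain_flatten, List.isChain_map, Cycle.chain_coe_cons]
    · refine and_congr_left fun _ => ?_
      simp only [List.mem_map, forall_exists_index, and_imp, forall_apply_eq_imp_iff₂]
      simp only [List.mem_cons, List.mem_append, List.not_mem_nil, or_false]
      exact ⟨fun h c hc => h c (hc.imp_right Or.inl),
        fun h c hc => h c (hc.elim Or.inl fun hc => hc.elim Or.inr Or.inl)⟩
    · simp only [List.mem_map, not_exists, not_and]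
      exact fun a _ => hW a
  rw [← key]
  obtain ⟨x, p, hp⟩ := List.exists_cons_of_ne_nil (hW a)
  have e1 : (a :: t).flatMap W = x :: (p ++ t.flatMap W) := by
    simp [List.flatMap_cons, hp]
  have e2 : (a :: (t ++ [a])).flatMap W = (x :: (p ++ t.flatMap W)) ++ [x] ++ p := by
    simp [List.flatMap_cons, List.flatMap_append, hp]
  rw [e1, e2, Cycle.chain_coe_cons]
  constructor
  · intro h
    -- The cyclic chain closes at the first letter x, the block chain at the end of the first block
    -- x :: p. The overlap at x allows p to be appended, as it is already a chain after x.
    refine List.IsChain.append_overlap h ?_ (by simp)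
    exact h.infix ⟨[], t.flatMap W ++ [x], by simp⟩
  · exact fun h => h.left_of_append

theorem invRev_map {α β : Type*} {φ : α × Bool → β × Bool}
    (hφ : ∀ a, φ (a.1, !a.2) = ((φ a).1, !(φ a).2)) (l : List (α × Bool)) :
    (FreeGroup.invRev l).map φ = FreeGroup.invRev (l.map φ) := by
  simp only [FreeGroup.invRev, List.map_reverse, List.map_map]
  congr 2
  funext a
  simp [hφ]

theorem invRev_flatMap {α β : Type*} {W : α × Bool → List (β × Bool)}
    (hW : ∀ a, W (a.1, !a.2) = FreeGroup.invRev (W a)) (l : List (α × Bool)) :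
    (FreeGroup.invRev l).flatMap W = FreeGroup.invRev (l.flatMap W) := by
  induction l with
  | nil => rfl
  | cons a t ih =>
    rw [FreeGroup.invRev_cons, List.flatMap_append, ih, List.flatMap_cons, FreeGroup.invRev_append]
    congr 1
    simp [FreeGroup.invRev, hW]

theorem head?_invRev {α : Type*} (l : List (α × Bool)) :
    (FreeGroup.invRev l).head? = l.getLast?.map fun x => (x.1, !x.2) := by
  simp [FreeGroup.invRev, List.head?_reverse, List.getLast?_map]

theorem isCyclicallyReduced_of_cycleChain {α : Type*} {w : List (α × Bool)}
    (h : Cycle.Chain (fun a b : α × Bool => a.1 = b.1 → a.2 = b.2) (w : Cycle (α × Bool))) :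
    FreeGroup.IsCyclicallyReduced w := by
  obtain _ | ⟨a, t⟩ := w
  · simp
  rw [Cycle.chain_coe_cons, ← List.cons_append, List.isChain_append] at h
  refine ⟨h.1, fun x hx y hy => ?_⟩
  simp only [List.head?_cons, Option.mem_def, Option.some.injEq] at hy
  exact h.2.2 x hx y (by simp [hy])

theorem flatMap_congr_blocks {α β : Type*} {W W' : α → List β}
    (hlen : ∀ a, (W a).length = (W' a).length) {l : List α} (h : l.flatMap W = l.flatMap W') :
    ∀ a ∈ l, W a = W' a := by
  induction l with
  | nil => simp
  | cons b t ih =>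
    simp only [List.flatMap_cons] at h
    obtain ⟨h1, h2⟩ := List.append_inj h (hlen b)
    intro a ha
    rcases List.mem_cons.1 ha with rfl | ha
    · exact h1
    · exact ih h2 a ha

/-- Words that begin with distinct code words of the same length form a prefix code. -/
theorem flatMap_injective_of_prefix {α β : Type*} {W c : α → List β} {q : ℕ} (hq : 0 < q)
    (hc : Function.Injective c) (hlen : ∀ a, (c a).length = q) (hpre : ∀ a, c a <+: W a) :
    Function.Injective fun l : List α => l.flatMap W := by
  have hW : ∀ a, W a ≠ [] := fun a h => by
    have := hlen a
    have h0 := hpre a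
    rw [h, List.prefix_nil] at h0
    rw [h0] at this
    simp at this; omega
  intro l
  induction l with
  | nil =>
    intro l' h
    obtain _ | ⟨b, t'⟩ := l'
    · rfl
    · simp only [List.flatMap_nil, List.flatMap_cons] at h
      exact absurd (List.append_eq_nil_iff.1 h.symm).1 (hW b)
  | cons a t ih =>
    intro l' h
    obtain _ | ⟨b, t'⟩ := l'
    · simp only [List.flatMap_nil, List.flatMap_cons] at h
      exact absurd (List.append_eq_nil_iff.1 h).1 (hW a)
    · simp only [List.flatMap_cons] at h
      have h1 : c a <+: W a ++ t.flatMap W := (hpre a).trans (List.prefix_append _ _)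
      have h2 : c b <+: W a ++ t.flatMap W := h ▸ (hpre b).trans (List.prefix_append _ _)
      have h3 : c a = c b :=
        (List.prefix_of_prefix_length_le h1 h2 (by rw [hlen, hlen])).eq_of_length
          (by rw [hlen, hlen])
      have hab := hc h3
      subst hab
      rw [ih (List.append_cancel_left h)]

namespace TwoComplex

variable {m : ℕ} (Y : TwoComplex) (n : Y.E → ℕ+) (c : Y.Dart → Word m)

/-- Choices of reduced words along the divided edges, with prescribed ends. -/
abbrev Labeling : Type := (e : Y.E) → edgeWords m (n e) (c (e, true)) (c (e, false))

variable {Y n c}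

/-- The word along an oriented edge. -/
def dartWord (x : Y.Labeling n c) (a : Y.Dart) : Word m :=
  if a.2 then (x a.1).1 else FreeGroup.invRev (x a.1).1

/-- The word along the boundary of a face. -/
def faceWord (x : Y.Labeling n c) (f : Y.F) : Word m := (Y.bdry f).flatMap (dartWord x)

theorem dartWord_flip (x : Y.Labeling n c) (a : Y.Dart) :
    dartWord x (a.1, !a.2) = FreeGroup.invRev (dartWord x a) := by
  obtain ⟨e, b⟩ := a
  cases b <;> simp [dartWord, FreeGroup.invRev_invRev]

theorem length_dartWord (x : Y.Labeling n c) (a : Y.Dart) :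
    (dartWord x a).length = n a.1 := by
  unfold dartWord
  split_ifs
  · exact (x a.1).2.1
  · rw [FreeGroup.invRev_length]; exact (x a.1).2.1

theorem dartWord_ne_nil (x : Y.Labeling n c) (a : Y.Dart) : dartWord x a ≠ [] := by
  intro h
  have := length_dartWord x a
  rw [h] at this
  exact (n a.1).ne_zero this.symm

theorem isReduced_dartWord (x : Y.Labeling n c) (a : Y.Dart) :
    FreeGroup.IsReduced (dartWord x a) := by
  unfold dartWord
  split_ifs
  · exact (x a.1).2.2.1
  · exact isReduced_invRev (x a.1).2.2.1

theorem prefix_dartWord (x : Y.Labeling n c) (a : Y.Dart) : c a <+: dartWord x a := by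
  obtain ⟨e, b⟩ := a
  cases b
  · simpa [dartWord] using (x e).2.2.2.2
  · simpa [dartWord] using (x e).2.2.2.1

theorem head?_dartWord {col : Y.Dart → Fin m × Bool} (hcol : ∀ a, (c a).head? = some (col a))
    (x : Y.Labeling n c) (a : Y.Dart) : (dartWord x a).head? = some (col a) := by
  obtain ⟨t, ht⟩ := prefix_dartWord x a
  rw [← ht, List.head?_append, hcol]
  rfl

theorem length_faceWord (x : Y.Labeling n c) (f : Y.F) :
    (faceWord x f).length = ((Y.subdivide n).bdry f).length := by
  simp only [faceWord, subdivide, List.length_flatMap, length_dartWord]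
  congr 1
  refine List.map_congr_left fun a _ => ?_
  rw [divPath_eq]
  split_ifs <;> simp

/-- The word along a ends with the inverse of the first letter of the word along the inverse of a.
Hence a cancellation at a corner would be an equality of colours. -/
theorem isCyclicallyReduced_faceWord {col : Y.Dart → Fin m × Bool}
    (hcol : ∀ a, (c a).head? = some (col a))
    (hcorner : ∀ f, Cycle.Chain (fun a b => col (a.1, !a.2) ≠ col b) (Y.bdry f : Cycle Y.Dart))
    (x : Y.Labeling n c) (f : Y.F) : FreeGroup.IsCyclicallyReduced (faceWord x f) := by
  refine isCyclicallyReduced_of_cycleChain ?_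
  rw [faceWord, cycleChain_flatMap (dartWord_ne_nil x)]
  refine ⟨fun a _ => isReduced_dartWord x a, Cycle.Chain.imp ?_ (hcorner f)⟩
  intro a b hab y hy z hz h
  have h1 := head?_dartWord hcol x (a.1, !a.2)
  rw [dartWord_flip, head?_invRev, Option.mem_def.1 hy] at h1
  have h2 := head?_dartWord hcol x b
  rw [Option.mem_def.1 hz] at h2
  simp only [Option.map_some, Option.some.injEq] at h1 h2
  rw [← h1, ← h2] at hab
  obtain ⟨y1, y2⟩ := y
  obtain ⟨z1, z2⟩ := z
  simp only at h
  subst h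
  revert hab
  cases y2 <;> cases z2 <;> simp

theorem faceWord_ne_nil (x : Y.Labeling n c) (f : Y.F) : faceWord x f ≠ [] := by
  intro h
  obtain ⟨a, ha⟩ := List.exists_mem_of_ne_nil _ (Y.isReducedLoop_bdry f).1
  exact dartWord_ne_nil x a (List.flatMap_eq_nil_iff.1 h a ha)

/-- The words along oriented edges form a prefix code, so the boundary path can be decoded from the
face word. Inverting a face word inverts the path. -/
theorem faceWord_ne {q : ℕ} (hq : 0 < q) (hc : Function.Injective c)
    (hlen : ∀ a, (c a).length = q)
    (hbdry : ∀ f g, f ≠ g → Y.bdry f ≠ Y.bdry g ∧ Y.bdry f ≠ FreeGroup.invRev (Y.bdry g))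
    (x : Y.Labeling n c) {f g : Y.F} (hfg : f ≠ g) :
    faceWord x f ≠ faceWord x g ∧ faceWord x f ≠ FreeGroup.invRev (faceWord x g) := by
  have hinj := flatMap_injective_of_prefix hq hc hlen (prefix_dartWord x)
  refine ⟨fun h => (hbdry f g hfg).1 (hinj h), fun h => (hbdry f g hfg).2 (hinj ?_)⟩
  change faceWord x f = _
  rw [h, faceWord]
  exact (invRev_flatMap (dartWord_flip x) _).symm

/-- The letter on an oriented edge of the subdivision. -/
def edgeLetter (x : Y.Labeling n c) (a : (Y.divGraph n).Dart) : Fin m × Bool :=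
  let y := (x a.1.1).1[(a.1.2 : ℕ)]'(by rw [(x a.1.1).2.1]; exact a.1.2.2)
  if a.2 then y else (y.1, !y.2)

theorem edgeLetter_flip (x : Y.Labeling n c) (a : (Y.divGraph n).Dart) :
    edgeLetter x (a.1, !a.2) = ((edgeLetter x a).1, !(edgeLetter x a).2) := by
  obtain ⟨e, b⟩ := a
  cases b <;> simp [edgeLetter]

theorem divPath_flip (a : Y.Dart) :
    Y.divPath n (a.1, !a.2) = FreeGroup.invRev (Y.divPath n a) := by
  obtain ⟨e, b⟩ := a
  cases b <;> simp [divPath, FreeGroup.invRev_invRev]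

theorem map_edgeLetter_divPath (x : Y.Labeling n c) (a : Y.Dart) :
    (Y.divPath n a).map (edgeLetter x) = dartWord x a := by
  have htrue : ∀ e, (Y.divPath n (e, true)).map (edgeLetter x) = dartWord x (e, true) := by
    intro e
    have hl := (x e).2.1
    refine List.ext_getElem (by simp [divPath, dartWord, hl]) fun i h1 h2 => ?_
    simp [divPath, dartWord, edgeLetter]
  obtain ⟨e, b⟩ := a
  cases b
  · have h1 := divPath_flip (n := n) (e, true)
    have h2 := dartWord_flip x (e, true)
    simp only [Bool.not_true] at h1 h2
    rw [h1, h2, ← htrue]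
    exact invRev_map (edgeLetter_flip x) _
  · exact htrue e

/-- Planarity is assumed of the subdivisions only; this lemma and the next bring its consequences
back to Y, where they no longer depend on ℓ. -/
theorem bdry_subdivide_ne
    (h : ∀ f g, f ≠ g → (Y.subdivide n).bdry f ≠ (Y.subdivide n).bdry g ∧
      (Y.subdivide n).bdry f ≠ FreeGroup.invRev ((Y.subdivide n).bdry g)) (f g : Y.F)
    (hfg : f ≠ g) : Y.bdry f ≠ Y.bdry g ∧ Y.bdry f ≠ FreeGroup.invRev (Y.bdry g) := by
  refine ⟨fun he => (h f g hfg).1 ?_, fun he => (h f g hfg).2 ?_⟩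
  · change (Y.bdry f).flatMap _ = (Y.bdry g).flatMap _
    rw [he]
  · change (Y.bdry f).flatMap _ = FreeGroup.invRev ((Y.bdry g).flatMap _)
    rw [he]
    exact invRev_flatMap divPath_flip _

theorem exists_corner_coloring_of_subdivide {κ : Type*}
    (h : ∃ col : (Y.subdivide n).Dart → κ, ∀ f,
      Cycle.Chain (fun a b => col (a.1, !a.2) ≠ col b)
        ((Y.subdivide n).bdry f : Cycle (Y.subdivide n).Dart)) :
    ∃ col : Y.Dart → κ, ∀ f,
      Cycle.Chain (fun a b => col (a.1, !a.2) ≠ col b) (Y.bdry f : Cycle Y.Dart) := by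
  obtain ⟨col, hcol⟩ := h
  -- An oriented edge of Y takes the colour of the first edge of its path. The inverse of the last
  -- edge of that path is the first edge of the inverse path, so corners of Y are corners of the
  -- subdivision.
  refine ⟨fun a => col ((Y.divPath n a).head (Y.divPath_ne_nil n a)), fun f => ?_⟩
  have h1 := ((cycleChain_flatMap (Y.divPath_ne_nil n) (Y.bdry f)).1 (hcol f)).2
  refine Cycle.Chain.imp ?_ h1
  intro a b hab
  have h2 := hab _ (List.getLast?_eq_some_getLast (Y.divPath_ne_nil n a)) _
    (List.head?_eq_some_head (Y.divPath_ne_nil n b))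
  convert h2 using 2
  have h3 := head?_invRev (Y.divPath n a)
  rw [← divPath_flip, List.head?_eq_some_head (Y.divPath_ne_nil n _),
    List.getLast?_eq_some_getLast (Y.divPath_ne_nil n a)] at h3
  simp only [Option.map_some, Option.some.injEq] at h3
  exact congrArg col h3

/-- Reducedness holds vacuously: distinct faces have labels that differ even up to inversion, and
the two orientations of one face have different labels because a nonempty reduced word is not its
own inverse. -/
theorem fillable_of_faceWord_mem {q : ℕ} (hq : 0 < q) (hc : Function.Injective c)
    (hlen : ∀ a, (c a).length = q)
    (hbdry : ∀ f g, f ≠ g → Y.bdry f ≠ Y.bdry g ∧ Y.bdry f ≠ FreeGroup.invRev (Y.bdry g))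
    (R : Set (Word m)) (x : Y.Labeling n c)
    (hred : ∀ f, FreeGroup.IsReduced (faceWord x f)) (hx : ∀ f, faceWord x f ∈ R) :
    (Y.subdivide n).Fillable m R := by
  have hmap : ∀ f, ((Y.bdry f).flatMap (Y.divPath n)).map (edgeLetter x) = faceWord x f := by
    intro f
    rw [List.map_flatMap, faceWord]
    congr 1
    funext a
    exact map_edgeLetter_divPath x a
  refine ⟨⟨edgeLetter x, fun e b => edgeLetter_flip x (e, b),
    fun f => if f.2 then faceWord x f.1 else FreeGroup.invRev (faceWord x f.1), ?_, ?_, ?_⟩, ?_⟩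
  · rintro ⟨f, b⟩
    cases b
    · right; simpa [FreeGroup.invRev_invRev] using hx f
    · left; simpa using hx f
  · rintro f b
    cases b <;> simp [FreeGroup.invRev_invRev]
  · rintro ⟨f, b⟩
    cases b
    · simp only [orientedBdry, Bool.false_eq_true, if_false]
      exact (invRev_map (edgeLetter_flip x) _).trans (congrArg _ (hmap f))
    · simp only [orientedBdry, if_true]
      exact hmap f
  · rintro ⟨f, b⟩ ⟨g, b'⟩ hne heq
    exfalso
    simp only at heq
    by_cases hfg : f = g
    · subst hfg
      have hw := ne_invRev (hred f) (faceWord_ne_nil x f)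
      cases b <;> cases b' <;> simp at hne heq
      · exact hw heq.symm
      · exact hw heq
    · obtain ⟨h1, h2⟩ := faceWord_ne hq hc hlen hbdry x hfg
      cases b <;> cases b' <;> simp at heq
      · exact h1 (FreeGroup.invRev_injective heq)
      · exact h2 (by rw [← heq, FreeGroup.invRev_invRev])
      · exact h2 heq
      · exact h1 heq

-- Prescribed face words on A determine the labels of all edges around A. Only the other edges
-- remain free, and the upper and lower bounds on edge words differ by a constant factor per edge.
open Classical in
theorem card_filter_faceWord_mul_le [Fintype Y.E] [Fintype (Y.Labeling n c)] (hm : 2 ≤ m) {q : ℕ}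
    (hq : 0 < q) (hlen : ∀ a, (c a).length = q) (hred : ∀ a, FreeGroup.IsReduced (c a))
    (hn : ∀ e, 2 * q + 1 ≤ (n e : ℕ)) (A : Finset Y.F) (v : Y.F → Word m) :
    (Finset.univ.filter fun y : Y.Labeling n c => ∀ f ∈ A, faceWord y f = v f).card *
      (2 * m - 1) ^ (∑ e ∈ Finset.univ.filter (fun e => ∃ f ∈ A, ∃ a ∈ Y.bdry f, a.1 = e), (n e : ℕ))
      ≤ (2 * (2 * m - 1) ^ (2 * q + 1)) ^ Fintype.card Y.E * Fintype.card (Y.Labeling n c) := by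
  set EA : Finset Y.E := Finset.univ.filter (fun e => ∃ f ∈ A, ∃ a ∈ Y.bdry f, a.1 = e)
  set b := 2 * m - 1
  set S := Finset.univ.filter fun y : Y.Labeling n c => ∀ f ∈ A, faceWord y f = v f
  have hS : S.card ≤ ∏ e ∈ EAᶜ, 2 * b ^ (n e : ℕ) := by
    let φ : S → (e : {e // e ∈ EAᶜ}) → edgeWords m (n e) (c (e, true)) (c (e, false)) :=
      fun y e => y.1 e
    have hφ : Function.Injective φ := by
      rintro ⟨y, hy⟩ ⟨z, hz⟩ h
      refine Subtype.ext (funext fun e => ?_)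
      by_cases he : e ∈ EA
      · obtain ⟨f, hf, a, ha, rfl⟩ := (Finset.mem_filter.1 he).2
        have h1 := (Finset.mem_filter.1 hy).2 f hf
        have h2 := (Finset.mem_filter.1 hz).2 f hf
        have h3 := flatMap_congr_blocks
          (fun a => (length_dartWord y a).trans (length_dartWord z a).symm)
          (h1.trans h2.symm) a ha
        unfold dartWord at h3
        split_ifs at h3
        · exact Subtype.ext h3
        · exact Subtype.ext (FreeGroup.invRev_injective h3)
      · exact congrFun h ⟨e, Finset.mem_compl.2 he⟩
    have h1 := Nat.card_le_card_of_injective φ hφ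
    rw [Nat.card_eq_fintype_card, Fintype.card_coe, Nat.card_pi,
      Finset.prod_coe_sort EAᶜ (fun e => Nat.card (edgeWords m (n e) (c (e, true)) (c (e, false))))] at h1
    exact h1.trans (Finset.prod_le_prod' fun e _ => card_edgeWords_le hm _ _ _)
  have hN : ∏ e, b ^ ((n e : ℕ) - (2 * q + 1)) ≤ Fintype.card (Y.Labeling n c) := by
    rw [← Nat.card_eq_fintype_card, Nat.card_pi]
    exact Finset.prod_le_prod' fun e _ =>
      le_card_edgeWords hm (hred _) (hred _) (hlen _) (hlen _) hq (hn e)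
  calc S.card * b ^ (∑ e ∈ EA, (n e : ℕ))
      ≤ (∏ e ∈ EAᶜ, 2 * b ^ (n e : ℕ)) * ∏ e ∈ EA, 2 * b ^ (n e : ℕ) := by
        rw [← Finset.prod_pow_eq_pow_sum]
        -- The superfluous factor 2 on the edges of `EA` makes the two products combine into one
        -- over all edges.
        exact Nat.mul_le_mul hS (Finset.prod_le_prod' fun e _ => by omega)
    _ = ∏ e, 2 * b ^ (n e : ℕ) := Finset.prod_compl_mul_prod _ _
    _ = ∏ e, (2 * b ^ (2 * q + 1)) * b ^ ((n e : ℕ) - (2 * q + 1)) := by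
        refine Finset.prod_congr rfl fun e _ => ?_
        rw [mul_assoc, ← pow_add, Nat.add_sub_cancel' (hn e)]
    _ = (2 * b ^ (2 * q + 1)) ^ Fintype.card Y.E * ∏ e, b ^ ((n e : ℕ) - (2 * q + 1)) := by
        rw [Finset.prod_mul_distrib, Finset.prod_const, Finset.card_univ]
    _ ≤ _ := Nat.mul_le_mul_left _ hN

end TwoComplex

end Labelings
-- Isoperimetry and the probability of not being fillable
section Fillability

namespace TwoComplex

variable {m : ℕ} {Y : TwoComplex} {n : Y.E → ℕ+}

/-- The edges of `Y` on the boundaries of the faces in `A`. -/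
noncomputable def bdryEdges [Fintype Y.E] (A : Finset Y.F) : Finset Y.E :=
  open Classical in Finset.univ.filter fun e => ∃ f ∈ A, ∃ a ∈ Y.bdry f, a.1 = e

theorem fst_of_mem_divPath {a : Y.Dart} {x : (Y.divGraph n).Dart} (h : x ∈ Y.divPath n a) :
    x.1.1 = a.1 := by
  rw [divPath_eq] at h
  split_ifs at h
  · obtain ⟨i, rfl⟩ := List.mem_ofFn.1 h; rfl
  · obtain ⟨i, rfl⟩ := List.mem_ofFn.1 (List.mem_reverse.1 h); rfl

theorem mem_divPath (a : Y.Dart) (i : Fin (n a.1 : ℕ)) :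
    ((⟨a.1, i⟩, a.2) : (Y.divGraph n).Dart) ∈ Y.divPath n a := by
  obtain ⟨e, b⟩ := a
  rw [divPath_eq]
  cases b
  · simp
  · simp

theorem ncard_edges_closure_subdivide [Fintype Y.E] (A : Finset Y.F) :
    (closure (D := Y.subdivide n) (A : Set Y.F)).edges.ncard = ∑ e ∈ bdryEdges A, (n e : ℕ) := by
  classical
  let T : Finset (Σ e : Y.E, Fin (n e : ℕ)) := (bdryEdges A).sigma fun _ => Finset.univ
  have hT : ∀ e i, (⟨e, i⟩ : Σ e : Y.E, Fin (n e : ℕ)) ∈ T ↔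
      ∃ f ∈ A, ∃ a ∈ Y.bdry f, a.1 = e := fun e i => by simp [T, bdryEdges]
  have h : (closure (D := Y.subdivide n) (A : Set Y.F)).edges =
      (T : Set (Σ e : Y.E, Fin (n e : ℕ))) := by
    ext ⟨e, i⟩
    refine Iff.trans ?_ (hT e i).symm
    constructor
    · rintro ⟨f, hf, x, hx, hxe⟩
      obtain ⟨a, ha, hxa⟩ := List.mem_flatMap.1 hx
      exact ⟨f, hf, a, ha, by rw [← fst_of_mem_divPath hxa, hxe]⟩
    · rintro ⟨f, hf, a, ha, rfl⟩
      exact ⟨f, hf, _, List.mem_flatMap.2 ⟨a, ha, mem_divPath a i⟩, rfl⟩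
  rw [h]
  exact (Set.ncard_coe_finset T).trans (by simp [T])

/-- In 2E(A) = |A|ℓ + |∂A| the boundary is at least (2κ - 1)|A|ℓ, so E(A) is at least κℓ|A|. The
hypothesis is used for closures of sets of faces. -/
theorem IsPlanar.le_sum_bdryEdges [Fintype Y.E] (hD : (Y.subdivide n).IsPlanar) {ℓ : ℕ}
    (hlength : ∀ f, ((Y.subdivide n).bdry f).length = ℓ) {κ : ℝ}
    (hiso : ∀ Z : (Y.subdivide n).Sub,
      (2 * κ - 1) * (Z.faces.ncard : ℝ) * (ℓ : ℝ) ≤ (Z.bdryLength : ℝ)) (A : Finset Y.F) :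
    κ * ℓ * A.card ≤ ((∑ e ∈ bdryEdges A, (n e : ℕ) : ℕ) : ℝ) := by
  classical
  have : Fintype (Y.subdivide n).F := Fintype.ofFinite _
  have h1 := hD.two_mul_ncard_edges (closure (D := Y.subdivide n) (A : Set Y.F)) A rfl
  have h2 := hiso (closure (D := Y.subdivide n) (A : Set Y.F))
  have h5 : ∑ f ∈ A, ((Y.subdivide n).bdry f).length = A.card * ℓ :=
    (Finset.sum_congr rfl fun f _ => hlength f).trans (Finset.sum_const ℓ)
  replace h1 := h1.trans (congrArg (· + _) h5)
  rw [ncard_edges_closure_subdivide] at h1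
  have h3 : (closure (D := Y.subdivide n) (A : Set Y.F)).faces.ncard = A.card :=
    Set.ncard_coe_finset A
  rw [h3] at h2
  have h4 : (2 : ℝ) * ((∑ e ∈ bdryEdges A, (n e : ℕ) : ℕ) : ℝ) = (A.card : ℝ) * ℓ +
      ((closure (D := Y.subdivide n) (A : Set Y.F)).bdryLength : ℝ) := by
    exact_mod_cast h1
  nlinarith

theorem sum_bdryEdges_singleton_le [Fintype Y.E] (f : Y.F) :
    ∑ e ∈ bdryEdges {f}, (n e : ℕ) ≤ ((Y.subdivide n).bdry f).length := by
  rw [← ncard_edges_closure_subdivide, Finset.coe_singleton]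
  exact ncard_edges_closure_singleton_le (D := Y.subdivide n) f

/-- The second moment bound applied to the face words, for a fixed ℓ. Here ρ bounds 2|B_ℓ|/r, and τ
measures by how much the edge count around any set of faces beats the powers of ρ. -/
theorem measureReal_not_fillable_le [Fintype Y.E] [Fintype Y.F] (hm : 2 ≤ m)
    {c : Y.Dart → Word m} {q : ℕ} (hq : 0 < q) (hc : Function.Injective c)
    (hlen : ∀ a, (c a).length = q) (hred : ∀ a, FreeGroup.IsReduced (c a))
    {col : Y.Dart → Fin m × Bool} (hcol : ∀ a, (c a).head? = some (col a))
    (hcorner : ∀ f, Cycle.Chain (fun a b => col (a.1, !a.2) ≠ col b) (Y.bdry f : Cycle Y.Dart))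
    (hbdry : ∀ f g, f ≠ g → Y.bdry f ≠ Y.bdry g ∧ Y.bdry f ≠ FreeGroup.invRev (Y.bdry g))
    (hn : ∀ e, 2 * q + 1 ≤ (n e : ℕ)) {ℓ : ℕ}
    (hlength : ∀ f, ((Y.subdivide n).bdry f).length = ℓ)
    {Ω : Type*} [MeasurableSpace Ω] (P : Measure Ω) [IsProbabilityMeasure P] (R : Ω → Set (B m ℓ))
    (hmeas : ∀ S, MeasurableSet {ω | R ω = S})
    (hinv : ∀ (π : Equiv.Perm (B m ℓ)) S, P {ω | R ω = π '' S} = P {ω | R ω = S})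
    (good : ℕ → Prop) {ρ τ : ℝ} (hτ0 : 0 ≤ τ)
    (hgood : ∀ r, good r → r ≤ Nat.card (B m ℓ) →
      0 < r ∧ 2 * Fintype.card Y.F ≤ r ∧ 2 * Nat.card (B m ℓ) / r ≤ ρ)
    (hτ : ∀ A : Finset Y.F, A.Nonempty →
      ρ ^ A.card ≤ τ * ((2 * m - 1 : ℕ) : ℝ) ^ (∑ e ∈ bdryEdges A, (n e : ℕ))) :
    P.real {ω | good (R ω).ncard ∧ ¬ (Y.subdivide n).Fillable m (Subtype.val '' R ω)} ≤
      2 ^ Fintype.card Y.F * (Fintype.card Y.F : ℝ) ^ Fintype.card Y.F *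
        (((2 * (2 * m - 1) ^ (2 * q + 1)) ^ Fintype.card Y.E : ℕ) * τ) := by
  classical
  have : Fintype (B m ℓ) := Fintype.ofFinite _
  have : ∀ e, Fintype (edgeWords m (n e) (c (e, true)) (c (e, false))) :=
    fun e => Fintype.ofFinite _
  have hne : ∀ e, Nonempty (edgeWords m (n e) (c (e, true)) (c (e, false))) := fun e =>
    (Nat.card_pos_iff.1 (lt_of_lt_of_le (pow_pos (by omega) _)
      (le_card_edgeWords hm (hred _) (hred _) (hlen _) (hlen _) hq (hn e)))).1
  have : Nonempty (Y.Labeling n c) := ⟨fun e => (hne e).some⟩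
  have hcyc := fun x f => isCyclicallyReduced_faceWord (n := n) hcol hcorner x f
  let w : Y.Labeling n c → Y.F → B m ℓ := fun x f =>
    ⟨faceWord x f, hcyc x f, by rw [length_faceWord]; exact (hlength f).le⟩
  have hw : ∀ x, Function.Injective (w x) := by
    intro x f g h
    by_contra hfg
    exact (faceWord_ne hq hc hlen hbdry x hfg).1 (congrArg Subtype.val h)
  set C : ℕ := (2 * (2 * m - 1) ^ (2 * q + 1)) ^ Fintype.card Y.E
  let bad : Finset (B m ℓ) → Prop := fun S => ∀ x, ∃ f, w x f ∉ S
  have hsub : {ω | good (R ω).ncard ∧ ¬ (Y.subdivide n).Fillable m (Subtype.val '' R ω)} ⊆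
      {ω | good (R ω).ncard ∧ bad (R ω).toFinset} := by
    rintro ω ⟨h1, h2⟩
    refine ⟨h1, fun x => ?_⟩
    by_contra! h
    refine h2 (fillable_of_faceWord_mem hq hc hlen hbdry _ x (fun f => (hcyc x f).1) fun f => ?_)
    exact ⟨w x f, by simpa using h f, rfl⟩
  refine (measureReal_mono hsub).trans ?_
  refine measureReal_le_of_card_filter_le P R hmeas hinv good bad _ (by positivity) fun r hr => ?_
  by_cases hrn : r ≤ Fintype.card (B m ℓ)
  · rw [← Nat.card_eq_fintype_card] at hrn
    obtain ⟨hr0, hr2, hrρ⟩ := hgood r hr hrn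
    rw [Nat.card_eq_fintype_card] at hrn hrρ
    have key := card_filter_powersetCard_le w hw r hr0 hr2 hrn (C * τ) (by positivity)
    refine le_trans (le_of_eq ?_) (key fun A hA v => ?_)
    · congr!
    have h1 := card_filter_faceWord_mul_le (n := n) hm hq hlen hred hn A fun f => (v f).1
    have h2 : (Finset.univ.filter fun y : Y.Labeling n c => ∀ f ∈ A, w y f = v f) =
        Finset.univ.filter fun y : Y.Labeling n c => ∀ f ∈ A, faceWord y f = (v f).1 := by
      ext y
      simp [w, Subtype.ext_iff]
    have h3 : ((Finset.univ.filter fun y : Y.Labeling n c =>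
        ∀ f ∈ A, faceWord y f = (v f).1).card : ℝ) *
          ((2 * m - 1 : ℕ) : ℝ) ^ (∑ e ∈ bdryEdges A, (n e : ℕ)) ≤
        (C : ℝ) * Fintype.card (Y.Labeling n c) := by
      have : ∀ a b c d : ℕ, a * b ≤ c * d → (a : ℝ) * b ≤ c * d := by
        intro a b c d h; exact_mod_cast h
      rw [← Nat.cast_pow]
      refine this _ _ _ _ ?_
      convert h1
      unfold bdryEdges
      congr!
    calc _ = ((Finset.univ.filter fun y : Y.Labeling n c =>
          ∀ f ∈ A, faceWord y f = (v f).1).card : ℝ) * (2 * Fintype.card (B m ℓ) / r) ^ A.card := by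
          rw [← h2]; congr!
      _ ≤ ((Finset.univ.filter fun y : Y.Labeling n c =>
          ∀ f ∈ A, faceWord y f = (v f).1).card : ℝ) * ρ ^ A.card := by gcongr
      _ ≤ ((Finset.univ.filter fun y : Y.Labeling n c =>
          ∀ f ∈ A, faceWord y f = (v f).1).card : ℝ) *
          (τ * ((2 * m - 1 : ℕ) : ℝ) ^ (∑ e ∈ bdryEdges A, (n e : ℕ))) := by
          gcongr
          exact hτ A hA
      _ ≤ τ * ((C : ℝ) * Fintype.card (Y.Labeling n c)) := by
          rw [mul_left_comm]
          gcongr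
      _ = _ := by ring
  -- A cardinality above |B_ℓ| does not occur.
  · rw [Finset.powersetCard_eq_empty.2 (by simpa using hrn)]
    simp only [Finset.filter_empty, Finset.card_empty, Nat.cast_zero]
    positivity

end TwoComplex

end Fillability
-- Asymptotic estimates
section Limit

theorem le_rpow_of_logb {N r d ε : ℝ} (hN : 1 < N) (hr : 0 < r) (h : |Real.logb N r - d| ≤ ε) :
    N ^ (d - ε) ≤ r := by
  rw [← Real.le_logb_iff_rpow_le hN hr]
  linarith [(abs_le.1 h).1]

theorem sub_le_one_of_logb {N r d ε : ℝ} (hN : 1 < N) (hr : 0 < r) (hrN : r ≤ N)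
    (h : |Real.logb N r - d| ≤ ε) : d - ε ≤ 1 := by
  have h1 := le_rpow_of_logb hN hr h
  have h2 : N ^ (d - ε) ≤ N ^ (1 : ℝ) := by rw [Real.rpow_one]; exact h1.trans hrN
  exact (Real.rpow_le_rpow_left_iff hN).1 h2

/-- The quotient is at most 2N^(1 - d + ε). Inserting the upper bound for N needs a nonnegative
exponent, which follows from r ≤ N through `sub_le_one_of_logb`. -/
theorem two_mul_div_le {N r d ε b : ℝ} {ℓ : ℕ} (hb : 0 < b) (hN : 1 < N) (hNb : N ≤ 3 * b ^ ℓ)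
    (hr : 0 < r) (hrN : r ≤ N) (h : |Real.logb N r - d| ≤ ε) :
    2 * N / r ≤ 2 * 3 ^ (1 - d + ε) * b ^ ((1 - d + ε) * ℓ) := by
  have h1 := le_rpow_of_logb hN hr h
  have h2 := sub_le_one_of_logb hN hr hrN h
  have hN0 : 0 < N := by linarith
  calc 2 * N / r ≤ 2 * N / N ^ (d - ε) := by gcongr
    _ = 2 * N ^ (1 - d + ε) := by
        rw [show 1 - d + ε = 1 - (d - ε) by ring, Real.rpow_sub hN0 1 (d - ε), Real.rpow_one]; ring
    _ ≤ 2 * (3 * b ^ ℓ) ^ (1 - d + ε) := by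
        gcongr
        linarith
    _ = _ := by
        rw [Real.mul_rpow (by norm_num) (by positivity), ← Real.rpow_natCast b ℓ,
          ← Real.rpow_mul hb.le, mul_comm (ℓ : ℝ)]
        ring

/-- Split b^(θℓ) as b^(-εℓ) b^((θ+ε)ℓ). The j-th power of the second factor is absorbed by b^E; the
first factor times K is at most 1, so its j-th power is at most itself, uniformly in j ≥ 1. -/
theorem pow_le_mul_pow {b K θ ε : ℝ} {ℓ j E : ℕ} (hb : 1 ≤ b) (hK : 0 ≤ K) (hj : 0 < j)
    (hE : (θ + ε) * ℓ * j ≤ E) (hτ : K * b ^ (-ε * ℓ) ≤ 1) :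
    (K * b ^ (θ * ℓ)) ^ j ≤ K * b ^ (-ε * ℓ) * b ^ E := by
  have hb0 : 0 < b := by linarith
  have hτ0 : 0 ≤ K * b ^ (-ε * ℓ) := by positivity
  have e : K * b ^ (θ * ℓ) = (K * b ^ (-ε * ℓ)) * b ^ ((θ + ε) * ℓ) := by
    rw [mul_assoc, ← Real.rpow_add hb0]
    congr 2
    ring
  rw [e, mul_pow, ← Real.rpow_natCast (b ^ ((θ + ε) * ℓ)) j, ← Real.rpow_mul hb0.le,
    ← Real.rpow_natCast b E]
  gcongr
  · calc (K * b ^ (-ε * ℓ)) ^ j ≤ (K * b ^ (-ε * ℓ)) ^ 1 :=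
          pow_le_pow_of_le_one hτ0 hτ hj
      _ = _ := pow_one _

theorem tendsto_const_mul_rpow_neg {b ε K : ℝ} (hb : 1 < b) (hε : 0 < ε) :
    Tendsto (fun ℓ : ℕ => K * b ^ (-ε * ℓ)) atTop (𝓝 0) := by
  have h1 : Tendsto (fun ℓ : ℕ => (b ^ (-ε)) ^ ℓ) atTop (𝓝 0) :=
    tendsto_pow_atTop_nhds_zero_of_lt_one (by positivity)
      (Real.rpow_lt_one_of_one_lt_of_neg hb (by linarith))
  have h2 := h1.const_mul K
  rw [mul_zero] at h2
  refine h2.congr fun ℓ => ?_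
  rw [Real.rpow_mul (by linarith), Real.rpow_natCast]

end Limit

end RandomGroups

/-! ### The main theorem -/

open RandomGroups in
theorem mainTheorem6 (m : ℕ) (hm : 2 ≤ m) (d : ℝ) {Ω : ℕ → Type*}
    [∀ ℓ, MeasurableSpace (Ω ℓ)] (P : ∀ ℓ, Measure (Ω ℓ)) [∀ ℓ, IsProbabilityMeasure (P ℓ)]
    (R : ∀ ℓ, Ω ℓ → Set (RandomGroups.B m ℓ)) (hR : RandomGroups.IsRandomRelators m d P R)
    (s : ℝ) (hs : 0 < s) (D : ℕ → RandomGroups.TwoComplex)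
    (hD : RandomGroups.SameGeometricForm D) (hplanar : ∀ᶠ ℓ in atTop, (D ℓ).IsPlanar)
    (hlength : ∀ᶠ ℓ in atTop, ∀ f, ((D ℓ).bdry f).length = ℓ)
    (hiso : ∀ᶠ ℓ in atTop, ∀ Z : (D ℓ).Sub,
      (1 - 2 * d + s) * (Z.faces.ncard : ℝ) * (ℓ : ℝ) ≤ (Z.bdryLength : ℝ)) :
    Tendsto (fun ℓ => P ℓ {ω | (D ℓ).Fillable m (Subtype.val '' R ℓ ω)}) atTop (𝓝 1) := by
  obtain ⟨Φ, n, hn, hform⟩ := hD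
  cases nonempty_fintype Φ.Y.E
  cases nonempty_fintype Φ.Y.F
  set b : ℝ := ((2 * m - 1 : ℕ) : ℝ) with hb
  have hb3 : 3 ≤ b := by rw [hb]; exact_mod_cast (by omega : 3 ≤ 2 * m - 1)
  -- Isoperimetry gives the exponent 1 - d + s/2 = θ + ε. One ε in it pays for the fluctuation of
  -- the density; the other remains as the decay rate.
  set ε := s / 4 with hε
  have hε0 : 0 < ε := by positivity
  set θ := 1 - d + ε with hθ
  have hev : ∀ᶠ ℓ in atTop, D ℓ = Φ.Y.subdivide (n ℓ) ∧ (Φ.Y.subdivide (n ℓ)).IsPlanar ∧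
      (∀ f, ((Φ.Y.subdivide (n ℓ)).bdry f).length = ℓ) ∧
      (∀ A : Finset Φ.Y.F, (θ + ε) * ℓ * A.card ≤
        ((∑ e ∈ TwoComplex.bdryEdges A, (n ℓ e : ℕ) : ℕ) : ℝ)) ∧ 0 < ℓ := by
    filter_upwards [hform, hplanar, hlength, hiso, eventually_gt_atTop 0] with ℓ h1 h2 h3 h4 h5
    rw [h1.1] at h2 h3 h4
    refine ⟨h1.1, h2, h3, h2.le_sum_bdryEdges h3 fun Z => ?_, h5⟩
    convert h4 Z using 3
    rw [hθ, hε]; ring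
  -- A single ℓ₀ provides the colouring and the code on Y. The prefix length q is thus constant
  -- while the edges grow linearly in ℓ.
  obtain ⟨ℓ₀, -, hpl, hlen₀, hE₀, hℓ₀⟩ := hev.exists
  obtain ⟨col, hcorner⟩ := TwoComplex.exists_corner_coloring_of_subdivide
    (hpl.exists_corner_coloring (κ := Fin m × Bool) (by simp; omega))
  have hbdry := TwoComplex.bdry_subdivide_ne fun f g => hpl.bdry_ne (f := f) (g := g)
  have : Finite Φ.Y.Dart := inferInstanceAs (Finite (Φ.Y.E × Bool))
  obtain ⟨q, hq, c, hc, hcode⟩ := exists_prefix_code hm col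
  have hlong : ∀ᶠ ℓ in atTop, ∀ e, 2 * q + 1 ≤ (n ℓ e : ℕ) := by
    refine eventually_all.2 fun e => ?_
    have h1 : Tendsto (fun ℓ : ℕ => ((n ℓ e : ℕ) : ℝ) / ℓ * ℓ) atTop atTop :=
      (hn e).pos_mul_atTop (Φ.len_pos e) tendsto_natCast_atTop_atTop
    filter_upwards [h1.eventually_ge_atTop ((2 * q + 1 : ℕ) : ℝ), eventually_gt_atTop 0]
      with ℓ h2 h3
    rw [div_mul_cancel₀ _ (by positivity)] at h2
    exact_mod_cast h2
  -- One face has at most ℓ₀ edges around it, so θ + ε ≤ 1. If there is a face, the density is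
  -- therefore positive and |R_ℓ| eventually exceeds twice the number of faces.
  have hd : ∀ f : Φ.Y.F, 2 * ε ≤ d := by
    intro f
    have h1 := hE₀ {f}
    have h2 := TwoComplex.sum_bdryEdges_singleton_le (n := n ℓ₀) f
    replace h2 := h2.trans (hlen₀ f).le
    have h3 : ((∑ e ∈ TwoComplex.bdryEdges {f}, (n ℓ₀ e : ℕ) : ℕ) : ℝ) ≤ ℓ₀ := by exact_mod_cast h2
    have h4 : (0 : ℝ) < ℓ₀ := by exact_mod_cast hℓ₀
    have h5 : (θ + ε) * ℓ₀ ≤ 1 * ℓ₀ := by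
      rw [Finset.card_singleton] at h1
      push_cast at h1 h3
      linarith
    have h6 := le_of_mul_le_mul_right h5 h4
    linarith
  have hlarge : ∀ᶠ ℓ : ℕ in atTop, 2 * (Fintype.card Φ.Y.F : ℝ) ≤ (ℓ : ℝ) ^ ε :=
    ((tendsto_rpow_atTop hε0).comp tendsto_natCast_atTop_atTop).eventually_ge_atTop _
  set K : ℝ := 2 * 3 ^ θ with hK
  have hK0 : 0 ≤ K := by positivity
  have hτ := tendsto_const_mul_rpow_neg (K := K) (by linarith : 1 < b) hε0
  set C : ℝ := 2 ^ Fintype.card Φ.Y.F * (Fintype.card Φ.Y.F : ℝ) ^ Fintype.card Φ.Y.F with hC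
  set C' : ℝ := (((2 * (2 * m - 1) ^ (2 * q + 1)) ^ Fintype.card Φ.Y.E : ℕ) : ℝ) with hC'
  -- Fillability can fail only when the cardinality of R_ℓ is atypical or when the second moment
  -- event occurs.
  have hbound : ∀ᶠ ℓ in atTop, (P ℓ).real {ω | (R ℓ ω).Nonempty ∧
      |Real.logb (Nat.card (B m ℓ)) ((R ℓ ω).ncard) - d| ≤ ε} - C * (C' * (K * b ^ (-ε * ℓ))) ≤
      (P ℓ).real {ω | (D ℓ).Fillable m (Subtype.val '' R ℓ ω)} := by
    filter_upwards [hev, hlong, hlarge, hτ.eventually_le_const one_pos] with ℓ h1 h2 h3 h4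
    obtain ⟨e1, hpl, hlen, hE, hℓ⟩ := h1
    have hN : ℓ < Nat.card (B m ℓ) := lt_card_B hm ℓ
    have hN' : (ℓ : ℝ) ≤ (Nat.card (B m ℓ) : ℝ) := by exact_mod_cast hN.le
    have hN1 : (1 : ℝ) < (Nat.card (B m ℓ) : ℝ) := by exact_mod_cast (by omega : 1 < Nat.card (B m ℓ))
    have hNb : (Nat.card (B m ℓ) : ℝ) ≤ 3 * b ^ ℓ := by
      rw [hb]; exact_mod_cast card_B_le hm ℓ
    have key := TwoComplex.measureReal_not_fillable_le hm hq hc (fun a => (hcode a).1)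
      (fun a => (hcode a).2.1) (fun a => (hcode a).2.2) hcorner hbdry h2 hlen (P ℓ) (R ℓ)
      (hR.measurable ℓ) (hR.invariant ℓ)
      (fun r => 0 < r ∧ |Real.logb (Nat.card (B m ℓ)) r - d| ≤ ε)
      (ρ := K * b ^ (θ * ℓ)) (τ := K * b ^ (-ε * ℓ)) (by positivity) ?_ ?_
    · rw [e1, sub_le_iff_le_add]
      refine le_trans ?_ (add_le_add_right key _)
      refine le_trans (measureReal_mono ?_) (measureReal_union_le _ _)
      rintro ω ⟨hω1, hω2⟩
      by_cases hf : (Φ.Y.subdivide (n ℓ)).Fillable m (Subtype.val '' R ℓ ω)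
      · exact Or.inl hf
      · exact Or.inr ⟨⟨(Set.ncard_pos (Set.toFinite _)).2 hω1, hω2⟩, hf⟩
    · rintro r ⟨hr0, hr⟩ hrN
      have hr0' : (0 : ℝ) < r := by exact_mod_cast hr0
      have hrN' : (r : ℝ) ≤ (Nat.card (B m ℓ) : ℝ) := by exact_mod_cast hrN
      refine ⟨hr0, ?_, two_mul_div_le (by linarith) hN1 hNb hr0' hrN' hr⟩
      rcases isEmpty_or_nonempty Φ.Y.F with hF | ⟨⟨f⟩⟩
      · simp
      · have h5 : (ℓ : ℝ) ^ ε ≤ r := by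
          calc (ℓ : ℝ) ^ ε ≤ (Nat.card (B m ℓ) : ℝ) ^ ε := by gcongr
            _ ≤ (Nat.card (B m ℓ) : ℝ) ^ (d - ε) := by
                gcongr
                · exact hN1.le
                · linarith [hd f]
            _ ≤ r := le_rpow_of_logb hN1 hr0' hr
        exact_mod_cast h3.trans h5
    · intro A hA
      exact pow_le_mul_pow (by linarith) hK0 hA.card_pos (hE A) h4
  have hdens := hR.densable ε hε0
  have hdens' : Tendsto (fun ℓ => (P ℓ).real {ω | (R ℓ ω).Nonempty ∧
      |Real.logb (Nat.card (B m ℓ)) ((R ℓ ω).ncard) - d| ≤ ε}) atTop (𝓝 1) := by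
    have := (ENNReal.tendsto_toReal ENNReal.one_ne_top).comp hdens
    simpa [Function.comp_def, measureReal_def] using this
  have hlow := hdens'.sub ((hτ.const_mul C').const_mul C)
  simp only [mul_zero, sub_zero] at hlow
  have hreal := tendsto_of_tendsto_of_tendsto_of_le_of_le' hlow tendsto_const_nhds hbound
    (Eventually.of_forall fun ℓ => measureReal_le_one)
  refine (ENNReal.tendsto_toReal_iff (fun ℓ => measure_ne_top _ _) ENNReal.one_ne_top).1 ?_
  simpa [measureReal_def] using hreal
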